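/- Let $\mathbb{H}^2$ be the hyperbolic plane of constant curvature $-1$, let $\mathbb{H}^2\times\mathbb{R}$ carry the product metric $\langle\cdot,\cdot\rangle$, let $\partial_z$ be the vertical unit Killing field, fix an origin $o\in\mathbb{H}^2$, and let $r(x)$ be the hyperbolic distance from $x$ to $o$. An orientable smooth surface $S$ (without boundary) immersed in $\mathbb{H}^2\times\mathbb{R}$, with unit normal $\eta$ and mean curvature $H$ (half the sum of the principal curvatures), is a \emph{translating soliton} if $H\,\eta=\partial_z^{\perp}$, that is, $H=\langle\eta,\partial_z\rangle$ at every point. The \emph{bowl soliton} $\mathcal{B}$ is the translating soliton, unique up to vertical translation, that is an entire vertical graph over $\mathbb{H}^2$ and is rotationally symmetric about the axis $\{o\}\times\mathbb{R}$. A properly immersed translating soliton with image $M\subset\mathbb{H}^2\times\mathbb{R}$ is \emph{$C^1$-asymptotic to $\mathcal{B}$} if for every $\varepsilon>0$ there are $R>0$ and a function $g$ on $\{x\in\mathbb{H}^2: r(x)>R\}$ such that the part of $M$ over $\{r\le R\}$ is bounded, the part of $M$ over $\{r>R\}$ is the graph of $g$, and, for all $x$ with $r(x)>R$ and all unit tangent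 vectors $v\in T_x\mathbb{H}^2$, the derivative $D_vg(x)$ exists and $$|g(x)-2r(x)|<\varepsilon,\qquad |D_vg(x)-2D_vr(x)|<\varepsilon .$$ \textbf{Theorem.} Let $\psi:S\to\mathbb{H}^2\times\mathbb{R}$ be a properly immersed connected translating soliton such that $S$ has a single end (for every compact $K\subset S$, exactly one connected component of $S\setminus K$ is not relatively compact) and such that $\psi(S)$ is $C^1$-asymptotic to the bowl soliton $\mathcal{B}$. Then $\psi(S)$ is a vertical translation of $\mathcal{B}$. More precisely, bowl solitons exist, $\psi$ is an embedding, and for every bowl soliton $\mathcal{B}$ there is $c\in\mathbb{R}$ with $\psi(S)=\mathcal{B}+(0,c)$. -/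

import Mathlib

open scoped Manifold ContDiff

noncomputable section

namespace HypTranslator

/-- The vector space underlying the Lorentz-Minkowski space, with coordinates
`(x₁, x₂, x₃) = (x 0, x 1, x 2)`. -/
abbrev L3 : Type := Fin 3 → ℝ

/-- The Euclidean plane, the model space of surfaces. -/
abbrev Plane : Type := EuclideanSpace ℝ (Fin 2)

/-- The Lorentzian product `x₁ y₁ + x₂ y₂ - x₃ y₃`. -/
def lor (x y : L3) : ℝ := x 0 * y 0 + x 1 * y 1 - x 2 * y 2

/-- The hyperbolic plane in the hyperboloid model; its metric is the restriction of `lor`. -/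
def H2 : Set L3 := {x | lor x x = -1 ∧ 0 < x 2}

/-- The product `lor + dz²` on `L3 × ℝ`; its restriction to the tangent spaces of
`H2 × ℝ` is the (positive definite) Riemannian product metric. -/
def amb (p q : L3 × ℝ) : ℝ := lor p.1 q.1 + p.2 * q.2

/-- The vertical unit Killing field `∂_z`. -/
def dz : L3 × ℝ := (0, 1)

/-- The hyperbolic distance from `x ∈ H2` to the origin `o = (0, 0, 1)`:
`cosh (d (x, o)) = -lor x o = x₃`. -/
def rad (x : L3) : ℝ := Real.arcosh (x 2)

/-- The geodesic of `H2` starting at `x` with the unit initial velocity `v`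
(where `lor x v = 0` and `lor v v = 1`). -/
def geod (x v : L3) (t : ℝ) : L3 := Real.cosh t • x + Real.sinh t • v

/-- The derivative `D_v f (x)` of a function `f` on `H2` in a unit tangent direction `v`. -/
def dirDeriv (f : L3 → ℝ) (x v : L3) : ℝ := deriv (fun t => f (geod x v t)) 0

section Surface

variable {S : Type*} [TopologicalSpace S] [ChartedSpace Plane S]

/-- The map `ψ` read in the preferred chart of the surface around `p`. -/
def localParam (ψ : S → L3 × ℝ) (p : S) : Plane → L3 × ℝ :=
  fun u => ψ ((extChartAt 𝓘(ℝ, Plane) p).symm u)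

/-- The `i`-th partial derivative of a map defined on the plane. -/
def partialD (i : Fin 2) (F : Plane → L3 × ℝ) (u : Plane) : L3 × ℝ :=
  fderiv ℝ F u (EuclideanSpace.single i 1)

/-- The matrix of the first fundamental form of `ψ` at `p`. -/
def firstForm (ψ : S → L3 × ℝ) (p : S) : Matrix (Fin 2) (Fin 2) ℝ :=
  Matrix.of fun i j =>
    amb (partialD i (localParam ψ p) (extChartAt 𝓘(ℝ, Plane) p p))
      (partialD j (localParam ψ p) (extChartAt 𝓘(ℝ, Plane) p p))

/-- The matrix of the second fundamental form of `ψ` at `p` with respect to a normal vector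
`n` that is tangent to `H2 × ℝ`. The Levi-Civita derivative of `H2 × ℝ` is the tangential
part of the flat derivative of `L3 × ℝ`, so its product with `n` is the product of the
flat second derivative with `n`. -/
def secondForm (ψ : S → L3 × ℝ) (p : S) (n : L3 × ℝ) : Matrix (Fin 2) (Fin 2) ℝ :=
  Matrix.of fun i j =>
    amb (partialD i (partialD j (localParam ψ p)) (extChartAt 𝓘(ℝ, Plane) p p)) n

/-- The mean curvature, i.e. half the sum of the principal curvatures. -/
def meanCurvature (ψ : S → L3 × ℝ) (p : S) (n : L3 × ℝ) : ℝ :=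
  (1 / 2) * Matrix.trace ((firstForm ψ p)⁻¹ * secondForm ψ p n)

/-- `ψ` is a (smooth) immersion of the surface `S` in `H2 × ℝ`. As `H2 × ℝ` is a closed embedded
submanifold of `L3 × ℝ`, smoothness and properness may be tested in `L3 × ℝ`. -/
structure IsImmersedSurface (ψ : S → L3 × ℝ) : Prop where
  mem_H2 : ∀ p, (ψ p).1 ∈ H2
  smooth : ContMDiff 𝓘(ℝ, Plane) 𝓘(ℝ, L3 × ℝ) ∞ ψ
  immersion : ∀ p, Function.Injective (mfderiv 𝓘(ℝ, Plane) 𝓘(ℝ, L3 × ℝ) ψ p)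

/-- `η` is a (continuous) unit normal field of the immersion `ψ` in `H2 × ℝ`: it is tangent
to `H2 × ℝ`, orthogonal to the surface, and of length one. -/
structure IsUnitNormal (ψ η : S → L3 × ℝ) : Prop where
  cont : Continuous η
  tangent : ∀ p, lor (ψ p).1 (η p).1 = 0
  normal : ∀ (p : S) (v : TangentSpace 𝓘(ℝ, Plane) p),
    amb (mfderiv 𝓘(ℝ, Plane) 𝓘(ℝ, L3 × ℝ) ψ p v : L3 × ℝ) (η p) = 0
  unit : ∀ p, amb (η p) (η p) = 1

/-- An oriented immersed surface is a translating soliton if `H = ⟨η, ∂_z⟩`, that is,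
`H η = ∂_z^⊥`. The condition does not depend on the choice of the orientation `η`. -/
def IsTranslatingSoliton (ψ : S → L3 × ℝ) : Prop :=
  IsImmersedSurface ψ ∧
    ∃ η : S → L3 × ℝ, IsUnitNormal ψ η ∧ ∀ p, meanCurvature ψ p (η p) = amb (η p) dz

end Surface

/-- `X` has a single end: the complement of each compact set has exactly one connected
component that is not relatively compact. -/
def HasSingleEnd (X : Type*) [TopologicalSpace X] : Prop :=
  ∀ K : Set X, IsCompact K →
    ∃! U : Set X, (∃ x ∈ Kᶜ, U = connectedComponentIn Kᶜ x) ∧ ¬ IsCompact (closure U)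

/-- The global parametrization of the hyperboloid by the plane. -/
def hypParam (w : Plane) : L3 := ![w 0, w 1, Real.sqrt (1 + w 0 ^ 2 + w 1 ^ 2)]

/-- The entire vertical graph over `H2` of the rotationally symmetric function `f ∘ rad`. -/
def rotGraph (f : ℝ → ℝ) (w : Plane) : L3 × ℝ := (hypParam w, f (rad (hypParam w)))

/-- `B` is a bowl soliton with axis `{o} × ℝ`: a rotational translating soliton that is an
entire vertical graph. -/
def IsBowlSoliton (B : Set (L3 × ℝ)) : Prop :=
  ∃ f : ℝ → ℝ, IsTranslatingSoliton (rotGraph f) ∧ B = Set.range (rotGraph f)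

/-- `M` is `C¹`-asymptotic to the bowl soliton: for each `ε > 0` there is `R > 0` such that,
up to a part contained in a ball around the origin `(o, 0)`, `M` is the graph of a function `g`
over the exterior of the disc of radius `R`, and `g` is `ε`-close to `2 r` together with its
derivatives in all unit directions. -/
def IsC1AsymptoticToBowl (M : Set (L3 × ℝ)) : Prop :=
  ∀ ε > 0, ∃ R > 0, ∃ g : L3 → ℝ,
    (∃ ρ : ℝ, ∀ q ∈ M, rad q.1 ≤ R → rad q.1 ^ 2 + q.2 ^ 2 ≤ ρ ^ 2) ∧
    (∀ x ∈ H2, R < rad x → ∀ z : ℝ, (x, z) ∈ M ↔ z = g x) ∧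
    (∀ x ∈ H2, R < rad x → |g x - 2 * rad x| < ε) ∧
    (∀ x ∈ H2, R < rad x → ∀ v : L3, lor x v = 0 → lor v v = 1 →
      DifferentiableAt ℝ (fun t => g (geod x v t)) 0 ∧
        |dirDeriv g x v - 2 * dirDeriv rad x v| < ε)

/-- The vertical translation of `B` by `c`. -/
def verticalTranslate (c : ℝ) (B : Set (L3 × ℝ)) : Set (L3 × ℝ) :=
  (fun q : L3 × ℝ => (q.1, q.2 + c)) '' B

end HypTranslator

end

namespace HypTranslator

open Set Filter Topology MeasureTheory

/-! With `s = cosh r = x₃`, a rotational graph `z = F(s)` is a soliton when its slope `P = F'`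
solves a first-order equation, `(s² - 1) P' + s P (2 + P² (s² - 1)) = 2 (1 + P² (s² - 1))`, which is
singular on the axis `s = 1`. A solution regular there with `2 / (s + 1) ≤ P ≤ 2 / s` yields a
height `F` with `F(cosh r) - 2 r → 0` (`exists_isBowlHeight`).

Uniqueness is a maximum principle with strict barriers. For `0 < |τ| ≤ 1/100` the profile `F + τ /
s` is a strict super- or subsolution according to the sign of `τ` (`IsBowlSlope.barrier`). Comparing
mean curvatures at a point of tangency (`IsImmersedSurface.touching`) shows that `τ (z - F - τ / s)`
has no local maximum on a translating soliton. On `S`, properness and the asymptotics give `z - F →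
0` at infinity, so a positive value of this function would force a maximum. Hence `τ (z - F) ≤ τ²`
for small `τ` of both signs, and `τ → 0` gives `z = F` on the surface
(`IsTranslatingSoliton.height_eq`). Strictness of the barriers replaces the strong maximum
principle.

A surface contained in the graph of `F` projects to the plane by a proper local homeomorphism, hence
by a homeomorphism; so `ψ` is an embedding onto the whole graph. The same barriers on discs show
that every bowl soliton is a translate of this graph. Smoothness of the graph, including at the
axis, is inherited from `ψ`, and the existence of a bowl soliton follows. -/

/-! ### Proper local homeomorphisms to simply connected spaces -/

theorem isHomeomorph_of_isProperMap_of_isLocalHomeomorph {E X : Type*} [TopologicalSpace E]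
    [TopologicalSpace X] [T2Space E] [T2Space X] [ConnectedSpace E] [SimplyConnectedSpace X]
    [LocallyPathConnectedSpace X] {f : E → X} (hf : IsProperMap f) (hloc : IsLocalHomeomorph f) :
    IsHomeomorph f := by
  -- Fibres are compact by properness and discrete by local injectivity.
  have hfin : ∀ x, (f ⁻¹' {x}).Finite := fun x =>
    (hf.isCompact_preimage isCompact_singleton).finite
      (IsDiscrete.of_openPartialHomeomorph f subset_rfl fun e _ => by
        obtain ⟨φ, he, h⟩ := hloc e
        exact ⟨φ, he, h.symm⟩)
  have hcov : IsCoveringMap f := isCoveringMap_iff_isCoveringMapOn_univ.2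
    (hf.isClosedMap.isCoveringMapOn_of_isLocalHomeomorphOn (fun x _ => hfin x)
      (isLocalHomeomorph_iff_isLocalHomeomorphOn_univ.1 hloc))
  obtain ⟨e⟩ := (inferInstance : Nonempty E)
  -- Simple connectedness lifts the identity to a section `g`; then `g ∘ f` and `id` are two lifts
  -- of `f` that agree at `e`, hence everywhere.
  obtain ⟨g, ⟨hg, hfg⟩, -⟩ := hcov.existsUnique_continuousMap_lifts (.id X) (f e) e rfl
  have hgf : g ∘ f = id := hcov.eq_of_comp_eq (g.continuous.comp hf.continuous) continuous_id
    (by rw [← Function.comp_assoc, hfg]; rfl) e hg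
  refine ⟨hf.continuous, hloc.isOpenMap, ?_, fun x => ⟨g x, congrFun hfg x⟩⟩
  exact Function.LeftInverse.injective (congrFun hgf)

/-! ### The slope equation as a fixed point problem -/

/-- The nonlinearity `2 y² - s y³` of the slope equation, with `y` truncated to `[0, 2 / s]`. -/
noncomputable def truncCubic (s y : ℝ) : ℝ :=
  2 * max 0 (min y (2 / s)) ^ 2 - s * max 0 (min y (2 / s)) ^ 3

theorem truncCubic_nonneg {s : ℝ} (hs : 1 ≤ s) (y : ℝ) : 0 ≤ truncCubic s y := by
  have h0 : 0 ≤ max 0 (min y (2 / s)) := le_max_left _ _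
  have h1 : max 0 (min y (2 / s)) ≤ 2 / s := max_le (by positivity) (min_le_right _ _)
  unfold truncCubic
  generalize max 0 (min y (2 / s)) = c at *
  rw [le_div_iff₀ (by linarith)] at h1
  have : 0 ≤ c ^ 2 * (2 - c * s) := by
    have : 0 ≤ 2 - c * s := by linarith
    positivity
  linarith

theorem truncCubic_le {s : ℝ} (hs : 1 ≤ s) (y : ℝ) : truncCubic s y ≤ 2 := by
  have h0 : 0 ≤ max 0 (min y (2 / s)) := le_max_left _ _
  have h1 : max 0 (min y (2 / s)) ≤ 2 / s := max_le (by positivity) (min_le_right _ _)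
  unfold truncCubic
  generalize max 0 (min y (2 / s)) = c at *
  rw [le_div_iff₀ (by linarith)] at h1
  have h2 : c ^ 3 ≤ s * c ^ 3 := by
    have : 0 ≤ c ^ 3 := by positivity
    nlinarith
  nlinarith [mul_nonneg h0 (sq_nonneg (c - 1)), sq_nonneg (c - 1)]

theorem abs_truncCubic_sub_le {s : ℝ} (hs : 1 ≤ s) (y z : ℝ) :
    |truncCubic s y - truncCubic s z| ≤ 12 * |y - z| := by
  have key : |max 0 (min y (2 / s)) - max 0 (min z (2 / s))| ≤ |y - z| :=
    (abs_max_sub_max_le_max _ _ _ _).trans (by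
      simpa using (abs_min_sub_min_le_max y (2 / s) z (2 / s)).trans (by simp))
  have h0 : 0 ≤ max 0 (min y (2 / s)) := le_max_left _ _
  have h1 : max 0 (min y (2 / s)) ≤ 2 / s := max_le (by positivity) (min_le_right _ _)
  have h0' : 0 ≤ max 0 (min z (2 / s)) := le_max_left _ _
  have h1' : max 0 (min z (2 / s)) ≤ 2 / s := max_le (by positivity) (min_le_right _ _)
  unfold truncCubic
  generalize max 0 (min y (2 / s)) = c at *
  generalize max 0 (min z (2 / s)) = d at *
  rw [le_div_iff₀ (by linarith)] at h1 h1'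
  have hc : c ≤ 2 := by nlinarith
  have hd : d ≤ 2 := by nlinarith
  have : 2 * c ^ 2 - s * c ^ 3 - (2 * d ^ 2 - s * d ^ 3) =
      (2 * (c + d) - (c * (c * s) + c * (d * s) + d * (d * s))) * (c - d) := by ring
  rw [this, abs_mul]
  -- As `c, d ≤ 2` and `c s, d s ≤ 2`, the first factor lies between `-12` and `8`.
  refine mul_le_mul ?_ key (abs_nonneg _) (by norm_num)
  have e1 : c * (c * s) ≤ c * 2 := by gcongr
  have e2 : c * (d * s) ≤ c * 2 := by gcongr
  have e3 : d * (d * s) ≤ d * 2 := by gcongr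
  have e4 : 0 ≤ c * (c * s) := by positivity
  have e5 : 0 ≤ c * (d * s) := by positivity
  have e6 : 0 ≤ d * (d * s) := by positivity
  rw [abs_le]
  constructor <;> linarith

theorem continuous_truncCubic {g : ℝ → ℝ} (hg : Continuous g) :
    Continuous fun s => truncCubic (max s 1) (g s) := by
  have : ∀ s : ℝ, max s 1 ≠ 0 := fun s => (lt_of_lt_of_le one_pos (le_max_right s 1)).ne'
  have h2 : Continuous fun s : ℝ => 2 / max s 1 :=
    continuous_const.div (continuous_id.max continuous_const) this
  have := continuous_const (y := (0 : ℝ)) |>.max (hg.min h2)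
  unfold truncCubic
  exact (continuous_const.mul (this.pow 2)).sub ((continuous_id.max continuous_const).mul (this.pow 3))

/-- The primitive of `(s² - 1) k` on `[1, ∞)`, extended by `0` to the left. -/
noncomputable def weightedPrimitive (k : ℝ → ℝ) (s : ℝ) : ℝ :=
  ∫ t in (1 : ℝ)..s, (max t 1 ^ 2 - 1) * k t

theorem continuous_weight : Continuous fun t : ℝ => max t 1 ^ 2 - 1 := by fun_prop

theorem weight_nonneg (t : ℝ) : 0 ≤ max t 1 ^ 2 - 1 := by
  nlinarith [le_max_right t 1]

theorem weightedPrimitive_of_le {k : ℝ → ℝ} {s : ℝ} (hs : s ≤ 1) : weightedPrimitive k s = 0 := by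
  unfold weightedPrimitive
  rw [intervalIntegral.integral_congr (g := fun _ => 0)]
  · simp
  · intro t ht
    rw [uIcc_of_ge hs] at ht
    simp [max_eq_right ht.2]

theorem hasDerivAt_weightedPrimitive {k : ℝ → ℝ} (hk : Continuous k) (s : ℝ) :
    HasDerivAt (weightedPrimitive k) ((max s 1 ^ 2 - 1) * k s) s :=
  intervalIntegral.integral_hasDerivAt_right ((continuous_weight.mul hk).intervalIntegrable _ _)
    ((continuous_weight.mul hk).stronglyMeasurableAtFilter _ _) (continuous_weight.mul hk).continuousAt

/-- The weight `t² - 1` is increasing, so it is at most its value at `s`. That value cancels the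
singular denominator of `slopeStep`. -/
theorem abs_weightedPrimitive_le {k g : ℝ → ℝ} (hg : Continuous g)
    (h : ∀ t, 1 ≤ t → |k t| ≤ g t) {s : ℝ} (hs : 1 ≤ s) :
    |weightedPrimitive k s| ≤ (s ^ 2 - 1) * ∫ t in (1 : ℝ)..s, g t := by
  unfold weightedPrimitive
  rw [← Real.norm_eq_abs, ← intervalIntegral.integral_const_mul]
  refine intervalIntegral.norm_integral_le_of_norm_le hs (ae_of_all _ fun t ht => ?_)
    ((continuous_const.mul hg).intervalIntegrable _ _)
  rw [norm_mul, Real.norm_of_nonneg (weight_nonneg t), max_eq_left ht.1.le]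
  have := h t ht.1.le
  refine mul_le_mul ?_ this (abs_nonneg _) ?_ <;> nlinarith [ht.1, ht.2]

theorem abs_weightedPrimitive_div_le {k : ℝ → ℝ} {M : ℝ}
    (h : ∀ t, 1 ≤ t → |k t| ≤ M) (s : ℝ) :
    |weightedPrimitive k s / (max s 1 ^ 2 - 1)| ≤ M * (max s 1 - 1) := by
  rcases le_or_gt s 1 with hs | hs
  · simp [max_eq_right hs]
  · rw [max_eq_left hs.le, abs_div, abs_of_pos (by nlinarith : (0 : ℝ) < s ^ 2 - 1),
      div_le_iff₀ (by nlinarith)]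
    refine (abs_weightedPrimitive_le continuous_const h hs.le).trans_eq ?_
    simp
    ring

theorem continuous_weightedPrimitive_div {k : ℝ → ℝ} (hk : Continuous k) {M : ℝ}
    (h : ∀ t, 1 ≤ t → |k t| ≤ M) :
    Continuous fun s => weightedPrimitive k s / (max s 1 ^ 2 - 1) := by
  rw [continuous_iff_continuousAt]
  intro s
  rcases le_or_gt s 1 with hs | hs
  · have h0 : weightedPrimitive k s / (max s 1 ^ 2 - 1) = 0 := by simp [max_eq_right hs]
    simp only [ContinuousAt, h0]
    refine squeeze_zero_norm (abs_weightedPrimitive_div_le h) ?_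
    have : Continuous fun a : ℝ => M * (max a 1 - 1) := by fun_prop
    simpa [max_eq_right hs] using this.tendsto s
  · refine (hasDerivAt_weightedPrimitive hk s).continuousAt.div continuous_weight.continuousAt ?_
    rw [max_eq_left hs.le]
    nlinarith

/-- One step of the fixed point iteration for the slope of the bowl soliton. -/
noncomputable def slopeStep (g : ℝ → ℝ) (s : ℝ) : ℝ :=
  2 / (max s 1 + 1) + weightedPrimitive (fun t => truncCubic (max t 1) (g t)) s / (max s 1 ^ 2 - 1)

theorem abs_truncCubic_le (g : ℝ → ℝ) (t : ℝ) : |truncCubic (max t 1) (g t)| ≤ 2 := by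
  rw [abs_of_nonneg (truncCubic_nonneg (le_max_right _ _) _)]
  exact truncCubic_le (le_max_right _ _) _

theorem continuous_slopeStep {g : ℝ → ℝ} (hg : Continuous g) : Continuous (slopeStep g) := by
  refine .add (continuous_const.div (by fun_prop) fun s => ?_)
    (continuous_weightedPrimitive_div (continuous_truncCubic hg) fun t _ => abs_truncCubic_le g t)
  have := le_max_right s 1
  positivity

theorem abs_slopeStep_le (g : ℝ → ℝ) (s : ℝ) :
    |slopeStep g s| ≤ 2 * max s 1 := by
  have h1 := le_max_right s 1
  have h2 := abs_weightedPrimitive_div_le (fun t _ => abs_truncCubic_le g t) s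
  have h3 : |2 / (max s 1 + 1)| ≤ 1 := by
    rw [abs_of_nonneg (by positivity), div_le_one (by positivity)]
    linarith
  unfold slopeStep
  linarith [abs_add_le (2 / (max s 1 + 1))
    (weightedPrimitive (fun t => truncCubic (max t 1) (g t)) s / (max s 1 ^ 2 - 1))]

/-- The exponent `24` is twice the Lipschitz constant `12` of `truncCubic`: integrating `12 d e^(24
t)` gives at most `(d / 2) e^(24 s)`, a contraction by one half in the weighted norm. -/
theorem abs_slopeStep_sub_le {g h : ℝ → ℝ} (hg : Continuous g) (hh : Continuous h) {d : ℝ}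
    (hgh : ∀ t, 1 ≤ t → |g t - h t| ≤ Real.exp (24 * t) * d) (s : ℝ) :
    |slopeStep g s - slopeStep h s| ≤ Real.exp (24 * max s 1) * (d / 2) := by
  have hd : 0 ≤ d := by
    have := (abs_nonneg _).trans (hgh 1 le_rfl)
    exact nonneg_of_mul_nonneg_right this (Real.exp_pos _)
  have hk := (continuous_truncCubic hg)
  have hl := (continuous_truncCubic hh)
  rcases le_or_gt s 1 with hs | hs
  · simp only [slopeStep, weightedPrimitive_of_le hs]
    simpa using by positivity
  have e : slopeStep g s - slopeStep h s = weightedPrimitive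
      (fun t => truncCubic (max t 1) (g t) - truncCubic (max t 1) (h t)) s / (max s 1 ^ 2 - 1) := by
    unfold slopeStep weightedPrimitive
    rw [add_sub_add_left_eq_sub, ← sub_div, ← intervalIntegral.integral_sub]
    · simp only [mul_sub]
    · exact (continuous_weight.mul hk).intervalIntegrable _ _
    · exact (continuous_weight.mul hl).intervalIntegrable _ _
  rw [e, max_eq_left hs.le, abs_div, abs_of_pos (by nlinarith : (0 : ℝ) < s ^ 2 - 1),
    div_le_iff₀ (by nlinarith)]
  refine (abs_weightedPrimitive_le (g := fun t => 12 * d * Real.exp (24 * t))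
    (by fun_prop) (fun t ht => ?_) hs.le).trans ?_
  · rw [max_eq_left ht]
    have := abs_truncCubic_sub_le ht (g t) (h t)
    have := hgh t ht
    linarith
  · have : ∫ t in (1 : ℝ)..s, 12 * d * Real.exp (24 * t) =
        d / 2 * (Real.exp (24 * s) - Real.exp 24) := by
      rw [intervalIntegral.integral_const_mul,
        intervalIntegral.integral_comp_mul_left (fun x => Real.exp x) (by norm_num : (24 : ℝ) ≠ 0)]
      simp
      ring
    rw [this, mul_comm]
    have h24 := Real.exp_pos 24
    refine mul_le_mul_of_nonneg_right ?_ (by nlinarith)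
    nlinarith

theorem exists_slopeStep_eq_self : ∃ P : ℝ → ℝ, Continuous P ∧ slopeStep P = P := by
  have hc : Continuous fun s : ℝ => Real.exp (24 * max s 1) := by fun_prop
  have hc' : Continuous fun s : ℝ => Real.exp (-(24 * max s 1)) := by fun_prop
  -- The iteration is conjugated by the exponential weight, so that Banach's theorem applies in the
  -- ordinary sup norm.
  let T : BoundedContinuousFunction ℝ ℝ → BoundedContinuousFunction ℝ ℝ := fun w =>
    .ofNormedAddCommGroup
      (fun s => Real.exp (-(24 * max s 1)) * slopeStep (fun t => Real.exp (24 * max t 1) * w t) s)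
      (hc'.mul (continuous_slopeStep (hc.mul w.continuous))) 1 fun s => by
        have h1 := le_max_right s 1
        have := abs_slopeStep_le (fun t => Real.exp (24 * max t 1) * w t) s
        rw [norm_mul, Real.norm_of_nonneg (Real.exp_pos _).le, Real.exp_neg,
          inv_mul_le_iff₀ (Real.exp_pos _), mul_one]
        exact this.trans (by linarith [Real.add_one_le_exp (24 * max s 1)])
  have hT : ContractingWith (1 / 2) T := by
    refine ⟨by rw [← NNReal.coe_lt_coe]; norm_num, LipschitzWith.of_dist_le_mul fun v w => ?_⟩
    rw [BoundedContinuousFunction.dist_le (by positivity)]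
    intro s
    have key := abs_slopeStep_sub_le (hc.mul v.continuous) (hc.mul w.continuous) (d := dist v w)
      (fun t ht => by
        simp only [Pi.mul_apply]
        rw [← mul_sub, abs_mul, abs_of_pos (Real.exp_pos _), max_eq_left ht]
        gcongr
        exact BoundedContinuousFunction.dist_coe_le_dist (f := v) (g := w) t) s
    change |Real.exp (-(24 * max s 1)) * _ - Real.exp (-(24 * max s 1)) * _| ≤ _
    rw [← mul_sub, abs_mul, abs_of_pos (Real.exp_pos _), Real.exp_neg,
      inv_mul_le_iff₀ (Real.exp_pos _)]
    refine key.trans_eq ?_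
    push_cast
    ring
  obtain ⟨w, hw⟩ : ∃ w, T w = w := ⟨_, hT.fixedPoint_isFixedPt⟩
  refine ⟨fun t => Real.exp (24 * max t 1) * w t, hc.mul w.continuous, funext fun s => ?_⟩
  have := DFunLike.congr_fun hw s
  change Real.exp (-(24 * max s 1)) * slopeStep _ s = w s at this
  rw [← this, ← mul_assoc, ← Real.exp_add]
  simp

/-! ### Bounds and regularity of the slope -/

/-- `P` is the slope, with respect to `s = cosh r`, of a rotational translating soliton that meets
its axis and stays close to the slope `2 / s` of `2 log s`. -/
structure IsBowlSlope (P P' : ℝ → ℝ) : Prop where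
  cont : Continuous P
  deriv : ∀ s, 1 ≤ s → HasDerivAt P (P' s) s
  eqn : ∀ s, 1 ≤ s →
    (s ^ 2 - 1) * P' s + s * P s * (2 + P s ^ 2 * (s ^ 2 - 1)) = 2 * (1 + P s ^ 2 * (s ^ 2 - 1))
  lower : ∀ s, 1 ≤ s → 2 / (s + 1) ≤ P s
  upper : ∀ s, 1 ≤ s → P s ≤ 2 / s
  asymp : ∀ s, 1 ≤ s → (s ^ 2 - 1) * (2 / s - P s) ≤ 2

theorem slopeStep_fixed_of_le {P : ℝ → ℝ} (hfix : slopeStep P = P) {s : ℝ} (hs : s ≤ 1) :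
    P s = 1 := by
  rw [← congrFun hfix s, slopeStep, weightedPrimitive_of_le hs, max_eq_right hs]
  norm_num

/-- Integrated form of the slope equation, which reads `((s² - 1) P)' = 2 + (s² - 1) (2 P² - s P³)`
once the truncation is inactive. -/
theorem slopeStep_fixed_mul {P : ℝ → ℝ} (hfix : slopeStep P = P) {s : ℝ} (hs : 1 ≤ s) :
    (s ^ 2 - 1) * P s =
      2 * (s - 1) + weightedPrimitive (fun t => truncCubic (max t 1) (P t)) s := by
  rcases hs.eq_or_lt with rfl | hs
  · simp [weightedPrimitive]
  · have := congrFun hfix s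
    have h1 : s ^ 2 - 1 ≠ 0 := by nlinarith
    have h2 : s + 1 ≠ 0 := by linarith
    rw [← this, slopeStep, max_eq_left hs.le, mul_add, mul_div_cancel₀ _ h1]
    field_simp
    ring

theorem slopeStep_fixed_lower {P : ℝ → ℝ} (hfix : slopeStep P = P) {s : ℝ} (hs : 1 ≤ s) :
    2 / (s + 1) ≤ P s := by
  rw [← congrFun hfix s, slopeStep, max_eq_left hs]
  refine le_add_of_nonneg_right (div_nonneg ?_ (by nlinarith))
  refine intervalIntegral.integral_nonneg hs fun t ht => mul_nonneg (weight_nonneg t) ?_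
  exact truncCubic_nonneg (le_max_right _ _) _

/-- At a contact of `(s² - 1) P` with `(s² - 1) (2 / s)` the cubic term vanishes, so the former has
derivative `2`, strictly less than the derivative `2 + 2 / s²` of the latter: no crossing is
possible. With the lower bound this makes the truncation inactive. -/
theorem slopeStep_fixed_upper {P : ℝ → ℝ} (hP : Continuous P) (hfix : slopeStep P = P) {s : ℝ}
    (hs : 1 ≤ s) : P s ≤ 2 / s := by
  rcases hs.eq_or_lt with rfl | hs
  · rw [slopeStep_fixed_of_le hfix le_rfl]
    norm_num
  have hd : ∀ x ∈ Ico 1 s, HasDerivAt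
      (fun x => 2 * (x - 1) + weightedPrimitive (fun t => truncCubic (max t 1) (P t)) x)
      (2 * 1 + (x ^ 2 - 1) * truncCubic x (P x)) x := fun x hx => by
    have := hasDerivAt_weightedPrimitive (continuous_truncCubic hP) x
    rw [max_eq_left hx.1] at this
    exact (((hasDerivAt_id x).sub_const 1).const_mul 2).add this
  have hB : ∀ x ∈ Icc 1 s, HasDerivAt (fun x => (x ^ 2 - 1) * (2 / x)) (2 + 2 / x ^ 2) x :=
    fun x hx => by
      have hx0 : x ≠ 0 := by linarith [hx.1]
      have := ((hasDerivAt_pow 2 x).sub_const 1).mul ((hasDerivAt_inv hx0).const_mul 2)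
      simp only [div_eq_mul_inv]
      refine this.congr_deriv ?_
      field_simp
      ring
  have key := image_le_of_deriv_right_lt_deriv_boundary'
    (f := fun x => 2 * (x - 1) + weightedPrimitive (fun t => truncCubic (max t 1) (P t)) x)
    (B := fun x => (x ^ 2 - 1) * (2 / x)) (a := 1) (b := s)
    (fun x _ => (((continuous_const.mul (continuous_id.sub continuous_const)).continuousAt).add
      (hasDerivAt_weightedPrimitive (continuous_truncCubic hP) x).continuousAt).continuousWithinAt)
    (fun x hx => (hd x hx).hasDerivWithinAt) (by simp [weightedPrimitive])
    (fun x hx => (hB x hx).continuousAt.continuousWithinAt)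
    (fun x hx => (hB x ⟨hx.1, hx.2.le⟩).hasDerivWithinAt) (fun x hx hxB => ?_)
    (right_mem_Icc.2 hs.le)
  · simp only [← slopeStep_fixed_mul hfix hs.le] at key
    exact le_of_mul_le_mul_left key (by nlinarith)
  · have hx0 : 0 < x := by linarith [hx.1]
    have : (x ^ 2 - 1) * truncCubic x (P x) = 0 := by
      rcases hx.1.eq_or_lt with rfl | h1
      · simp
      · rw [← slopeStep_fixed_mul hfix hx.1] at hxB
        have h2 : P x = 2 / x := mul_left_cancel₀ (by nlinarith) hxB
        have h3 : (0 : ℝ) ≤ 2 / x := by positivity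
        rw [h2, truncCubic, min_self, max_eq_right h3]
        field_simp
        ring
    rw [this]
    have : 0 < 2 / x ^ 2 := by positivity
    linarith

theorem slopeStep_fixed_truncCubic {P : ℝ → ℝ} (hP : Continuous P) (hfix : slopeStep P = P) {s : ℝ}
    (hs : 1 ≤ s) : truncCubic s (P s) = 2 * P s ^ 2 - s * P s ^ 3 := by
  have h := slopeStep_fixed_lower hfix hs
  have h2 : 0 ≤ 2 / (s + 1) := by positivity
  rw [truncCubic, min_eq_left (slopeStep_fixed_upper hP hfix hs), max_eq_right (h2.trans h)]

theorem hasDerivAt_slopeStep_fixed_mul {P : ℝ → ℝ} (hP : Continuous P) (hfix : slopeStep P = P)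
    {s : ℝ} (hs : 1 ≤ s) : HasDerivAt
      (fun x => 2 * (x - 1) + weightedPrimitive (fun t => truncCubic (max t 1) (P t)) x)
      (2 + (s ^ 2 - 1) * (2 * P s ^ 2 - s * P s ^ 3)) s := by
  have := hasDerivAt_weightedPrimitive (continuous_truncCubic hP) s
  rw [max_eq_left hs, slopeStep_fixed_truncCubic hP hfix hs] at this
  exact ((((hasDerivAt_id s).sub_const 1).const_mul 2).add this).congr_deriv (by simp)

/-- The cubic is nonnegative, so `(s² - 1) P ≥ 2 s - 2`, whereas `(s² - 1) (2 / s) = 2 s - 2 / s`.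
-/
theorem slopeStep_fixed_asymp {P : ℝ → ℝ} (hP : Continuous P) (hfix : slopeStep P = P) {s : ℝ}
    (hs : 1 ≤ s) : (s ^ 2 - 1) * (2 / s - P s) ≤ 2 := by
  have hB : ∀ x ∈ Icc 1 s, HasDerivAt (fun x : ℝ => 2 * x - 2) 2 x := fun x hx =>
    (((hasDerivAt_id x).const_mul 2).sub_const 2).congr_deriv (by simp)
  have key := image_le_of_deriv_right_le_deriv_boundary
    (f := fun x : ℝ => 2 * x - 2)
    (B := fun x => 2 * (x - 1) + weightedPrimitive (fun t => truncCubic (max t 1) (P t)) x)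
    (a := 1) (b := s)
    (fun x hx => (hB x hx).continuousAt.continuousWithinAt)
    (fun x hx => (hB x ⟨hx.1, hx.2.le⟩).hasDerivWithinAt) (by simp [weightedPrimitive])
    (fun x hx => (hasDerivAt_slopeStep_fixed_mul hP hfix hx.1).continuousAt.continuousWithinAt)
    (fun x hx => (hasDerivAt_slopeStep_fixed_mul hP hfix hx.1).hasDerivWithinAt) (fun x hx => ?_)
    (right_mem_Icc.2 hs)
  · simp only [← slopeStep_fixed_mul hfix hs] at key
    have h1 : (s ^ 2 - 1) * (2 / s) = 2 * s - 2 / s := by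
      field_simp
    have h2 : 0 ≤ 2 / s := by positivity
    rw [mul_sub, h1]
    linarith
  · rw [← slopeStep_fixed_truncCubic hP hfix hx.1]
    have := truncCubic_nonneg hx.1 (P x)
    have := mul_nonneg (by nlinarith [hx.1] : (0 : ℝ) ≤ x ^ 2 - 1) this
    linarith

/-- Since `P 1 = 1`, the cubic equals `2 - 1 = 1` on the axis; this is the first-order error there.
-/
theorem abs_truncCubic_fixed_sub_one_le {P : ℝ → ℝ} (hP : Continuous P) (hfix : slopeStep P = P)
    {s : ℝ} (hs : 1 ≤ s) : |truncCubic (max s 1) (P s) - 1| ≤ 11 * (s - 1) := by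
  rw [max_eq_left hs]
  rcases le_or_gt 2 s with h2 | h2
  · have h3 := truncCubic_nonneg hs (P s)
    have h4 := truncCubic_le hs (P s)
    rw [abs_le]
    constructor <;> linarith
  have hl := slopeStep_fixed_lower hfix hs
  have hu : P s ≤ 2 / (s + 1) + 2 * (s - 1) := by
    have := (abs_le.1 (abs_weightedPrimitive_div_le (fun t _ => abs_truncCubic_le P t) s)).2
    nth_rewrite 1 [← congrFun hfix s]
    rw [slopeStep]
    rw [max_eq_left hs] at *
    linarith
  have hu2 := slopeStep_fixed_upper hP hfix hs
  rw [slopeStep_fixed_truncCubic hP hfix hs]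
  have e1 : 2 / (s + 1) ≤ 1 := by rw [div_le_one (by linarith)]; linarith
  have e2 : 1 - (s - 1) ≤ 2 / (s + 1) := by
    rw [le_div_iff₀ (by linarith)]; nlinarith
  have e3 : 2 / s ≤ 2 := by rw [div_le_iff₀ (by linarith)]; linarith
  have e4 : 2 / 3 ≤ 2 / (s + 1) := by gcongr; linarith
  have e5 : |P s - 1| ≤ 2 * (s - 1) := by rw [abs_le]; constructor <;> linarith
  have e6 : |P s ^ 2 - P s - 1| ≤ 3 / 2 := by rw [abs_le]; constructor <;> nlinarith
  have e7 : P s ^ 3 ≤ 2 ^ 3 := pow_le_pow_left₀ (by linarith) (by linarith) 3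
  have e8 : 0 ≤ P s ^ 3 := pow_nonneg (by linarith) 3
  have e9 : 2 * P s ^ 2 - s * P s ^ 3 - 1 =
      -((P s - 1) * (P s ^ 2 - P s - 1)) - (s - 1) * P s ^ 3 := by ring
  rw [e9]
  have f1 : |(P s - 1) * (P s ^ 2 - P s - 1)| ≤ 2 * (s - 1) * (3 / 2) := by
    rw [abs_mul]
    exact mul_le_mul e5 e6 (abs_nonneg _) (by linarith)
  have f2 : (s - 1) * P s ^ 3 ≤ (s - 1) * 2 ^ 3 := by gcongr
  have f3 : 0 ≤ (s - 1) * P s ^ 3 := mul_nonneg (by linarith) e8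
  rw [abs_le] at *
  constructor <;> linarith [f1.1, f1.2]

/-- Gives differentiability at the singular point `s = 1`, with derivative `0`. Replacing the cubic
by `1` leaves exactly `(s - 1)³ / 3`, which contributes `1/2` to the constant; the error of the
replacement contributes `11/2`. -/
theorem abs_slopeStep_fixed_sub_one_le {P : ℝ → ℝ} (hP : Continuous P) (hfix : slopeStep P = P)
    (s : ℝ) : |P s - 1| ≤ 6 * (s - 1) ^ 2 := by
  rcases le_or_gt s 1 with hs | hs
  · rw [slopeStep_fixed_of_le hfix hs]
    simpa using by positivity
  have hD : 0 < s ^ 2 - 1 := by nlinarith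
  have hk := continuous_truncCubic hP
  have i1 : weightedPrimitive (fun _ => 1) s = s ^ 3 / 3 - s + 2 / 3 := by
    unfold weightedPrimitive
    rw [intervalIntegral.integral_congr (g := fun t : ℝ => t ^ 2 - 1)]
    · rw [intervalIntegral.integral_sub (by simp) (by simp)]
      simp
      ring
    · intro t ht
      rw [uIcc_of_le hs.le] at ht
      simp [max_eq_left ht.1]
  have i2 : weightedPrimitive (fun t => truncCubic (max t 1) (P t) - 1) s =
      weightedPrimitive (fun t => truncCubic (max t 1) (P t)) s - weightedPrimitive (fun _ => 1) s := by
    unfold weightedPrimitive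
    rw [← intervalIntegral.integral_sub]
    · simp only [mul_sub]
    · exact (continuous_weight.mul hk).intervalIntegrable _ _
    · exact (continuous_weight.mul continuous_const).intervalIntegrable _ _
  have i3 : ∫ t in (1 : ℝ)..s, 11 * (t - 1) = 11 / 2 * (s - 1) ^ 2 := by
    rw [intervalIntegral.integral_const_mul, intervalIntegral.integral_sub (by simp) (by simp)]
    simp
    ring
  have key := abs_weightedPrimitive_le (g := fun t => 11 * (t - 1))
    (by fun_prop) (fun t ht => abs_truncCubic_fixed_sub_one_le hP hfix ht) hs.le
  rw [i2, i1, i3] at key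
  have e := slopeStep_fixed_mul hfix hs.le
  have e2 : (s ^ 2 - 1) * (P s - 1) = (s - 1) ^ 3 / 3 +
    (weightedPrimitive (fun t => truncCubic (max t 1) (P t)) s - (s ^ 3 / 3 - s + 2 / 3)) := by
    linear_combination e
  have e3 : (s - 1) ^ 3 / 3 ≤ (s ^ 2 - 1) * (1 / 2 * (s - 1) ^ 2) := by
    have : 0 ≤ (s - 1) ^ 3 := pow_nonneg (by linarith) 3
    nlinarith [mul_nonneg this (by linarith : (0 : ℝ) ≤ s)]
  have e4 : 0 ≤ (s - 1) ^ 3 / 3 := by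
    have : 0 ≤ (s - 1) ^ 3 := pow_nonneg (by linarith) 3
    linarith
  rw [← mul_le_mul_iff_of_pos_left hD, ← abs_of_pos hD, ← abs_mul, abs_of_pos hD, e2]
  rw [abs_le] at *
  constructor <;> linarith

theorem exists_isBowlSlope : ∃ P P' : ℝ → ℝ, IsBowlSlope P P' := by
  obtain ⟨P, hP, hfix⟩ := exists_slopeStep_eq_self
  -- At `s = 1` this quotient is `0` by the convention for division by zero, which is the true
  -- derivative there.
  refine ⟨P, fun s => (2 + (s ^ 2 - 1) * (2 * P s ^ 2 - s * P s ^ 3) - 2 * s * P s) / (s ^ 2 - 1),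
    hP, fun s hs => ?_, fun s hs => ?_, fun s hs => slopeStep_fixed_lower hfix hs,
    fun s hs => slopeStep_fixed_upper hP hfix hs, fun s hs => slopeStep_fixed_asymp hP hfix hs⟩
  · rcases hs.eq_or_lt with rfl | hs
    · have h1 : P 1 = 1 := slopeStep_fixed_of_le hfix le_rfl
      rw [hasDerivAt_iff_isLittleO]
      refine Asymptotics.IsBigO.trans_isLittleO (g := fun x : ℝ => (x - 1) ^ 2) ?_ ?_
      · refine .of_bound 6 (.of_forall fun x => ?_)
        simpa [h1] using abs_slopeStep_fixed_sub_one_le hP hfix x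
      · have := Asymptotics.isLittleO_pow_sub_sub (1 : ℝ) (m := 2) (by norm_num)
        simpa using this
    · have hD : s ^ 2 - 1 ≠ 0 := by nlinarith
      have h := (hasDerivAt_slopeStep_fixed_mul hP hfix hs.le).div
        ((hasDerivAt_pow 2 s).sub_const 1) hD
      refine (h.congr_of_eventuallyEq ?_).congr_deriv ?_
      · filter_upwards [eventually_gt_nhds hs] with x hx
        simp only [Pi.div_apply]
        rw [← slopeStep_fixed_mul hfix hx.le, mul_div_cancel_left₀]
        nlinarith
      · rw [← slopeStep_fixed_mul hfix hs.le]
        field_simp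
        ring
  · rcases hs.eq_or_lt with rfl | hs
    · have h1 : P 1 = 1 := slopeStep_fixed_of_le hfix le_rfl
      simp [h1]
    · rw [mul_div_cancel₀ _ (by nlinarith)]
      ring

/-! ### The height of the bowl -/

/-- `F` is the height, as a function of `s = cosh r`, of the bowl soliton that is asymptotic
to `2 r`. -/
structure IsBowlHeight (F P P' : ℝ → ℝ) : Prop where
  slope : IsBowlSlope P P'
  deriv : ∀ s, HasDerivAt F (P s) s
  tendsto : Tendsto (fun s => F s - 2 * Real.arcosh s) atTop (𝓝 0)

theorem tendsto_arcosh_sub_log :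
    Tendsto (fun s => Real.arcosh s - Real.log s) atTop (𝓝 (Real.log 2)) := by
  have h1 : Tendsto (fun s : ℝ => 1 + √(1 - (s⁻¹) ^ 2)) atTop (𝓝 2) := by
    have : Tendsto (fun s : ℝ => 1 + √(1 - (s⁻¹) ^ 2)) atTop (𝓝 (1 + √(1 - 0 ^ 2))) :=
      (((tendsto_inv_atTop_zero.pow 2).const_sub 1).sqrt).const_add 1
    convert this using 2
    norm_num
  refine (h1.log (by norm_num)).congr' ?_
  filter_upwards [eventually_ge_atTop 1] with s hs
  have hs0 : 0 < s := by linarith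
  have h2 : s + √(s ^ 2 - 1) = s * (1 + √(1 - (s⁻¹) ^ 2)) := by
    have : s ^ 2 - 1 = s ^ 2 * (1 - (s⁻¹) ^ 2) := by field_simp
    rw [this, Real.sqrt_mul (sq_nonneg s), Real.sqrt_sq hs0.le]
    ring
  rw [Real.arcosh, h2, Real.log_mul hs0.ne' (by positivity)]
  ring

/-- With `G` a primitive of `P`, the upper bound makes `G - 2 log s` decreasing, and the decay of `2
/ s - P` makes `G - 2 log s - 3 / s` increasing on `[2, ∞)`. Hence `G - 2 log s` converges, and a
constant normalises the limit. -/
theorem IsBowlSlope.exists_isBowlHeight {P P' : ℝ → ℝ} (h : IsBowlSlope P P') :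
    ∃ F, IsBowlHeight F P P' := by
  set G : ℝ → ℝ := fun s => ∫ t in (1 : ℝ)..s, P t
  have hG : ∀ s, HasDerivAt G (P s) s := fun s => h.cont.integral_hasStrictDerivAt 1 s |>.hasDerivAt
  have hV : ∀ s, 2 ≤ s → HasDerivAt (fun s => G s - 2 * Real.log s) (P s - 2 / s) s := fun s hs =>
    ((hG s).sub ((Real.hasDerivAt_log (by linarith)).const_mul 2)).congr_deriv (by ring)
  have hW : ∀ s, 2 ≤ s →
      HasDerivAt (fun s => G s - 2 * Real.log s - 3 * s⁻¹) (P s - 2 / s + 3 / s ^ 2) s := fun s hs =>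
    ((hV s hs).sub ((hasDerivAt_inv (by linarith)).const_mul 3)).congr_deriv (by ring)
  have hanti : AntitoneOn (fun s => G s - 2 * Real.log s) (Ici 2) := by
    refine antitoneOn_of_deriv_nonpos (convex_Ici 2)
      (fun s hs => (hV s hs).continuousAt.continuousWithinAt) (fun s hs => ?_) fun s hs => ?_
    · exact (hV s (interior_subset hs)).differentiableAt.differentiableWithinAt
    · have hs : 2 ≤ s := interior_subset hs
      rw [(hV s hs).deriv]
      linarith [h.upper s (by linarith)]
  have hmono : MonotoneOn (fun s => G s - 2 * Real.log s - 3 * s⁻¹) (Ici 2) := by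
    refine monotoneOn_of_deriv_nonneg (convex_Ici 2)
      (fun s hs => (hW s hs).continuousAt.continuousWithinAt) (fun s hs => ?_) fun s hs => ?_
    · exact (hW s (interior_subset hs)).differentiableAt.differentiableWithinAt
    · have hs : 2 ≤ s := interior_subset hs
      rw [(hW s hs).deriv]
      have h1 := h.asymp s (by linarith)
      have h2 : 2 / s - P s ≤ 3 / s ^ 2 := by
        have h0 : 0 ≤ 2 / s - P s := by linarith [h.upper s (by linarith)]
        rw [le_div_iff₀ (by positivity)]
        nlinarith [mul_nonneg h0 (by nlinarith : (0 : ℝ) ≤ s ^ 2 - 4)]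
      linarith
  have hanti' : Antitone fun s => G (max s 2) - 2 * Real.log (max s 2) := fun s t hst =>
    hanti (mem_Ici.2 (le_max_right _ _)) (mem_Ici.2 (le_max_right _ _)) (max_le_max_right 2 hst)
  have hbdd : BddBelow (range fun s => G (max s 2) - 2 * Real.log (max s 2)) := by
    refine ⟨G 2 - 2 * Real.log 2 - 3 * 2⁻¹, ?_⟩
    rintro _ ⟨s, rfl⟩
    have h1 := hmono self_mem_Ici (mem_Ici.2 (le_max_right s 2)) (le_max_right s 2)
    have h2 : 0 ≤ 3 * (max s 2)⁻¹ := by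
      have := le_max_right s 2
      positivity
    simp only at h1 ⊢
    linarith
  obtain ⟨L, hL⟩ : ∃ L, Tendsto (fun s => G s - 2 * Real.log s) atTop (𝓝 L) :=
    ⟨_, (tendsto_atTop_ciInf hanti' hbdd).congr' (by
      filter_upwards [eventually_ge_atTop 2] with s hs
      rw [max_eq_left hs])⟩
  refine ⟨fun s => G s - (L - 2 * Real.log 2), h, fun s => (hG s).sub_const _, ?_⟩
  have := (hL.sub (tendsto_arcosh_sub_log.const_mul 2)).sub_const (L - 2 * Real.log 2)
  rw [sub_self] at this
  refine this.congr fun s => ?_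
  ring

theorem exists_isBowlHeight : ∃ F P P' : ℝ → ℝ, IsBowlHeight F P P' := by
  obtain ⟨P, P', h⟩ := exists_isBowlSlope
  obtain ⟨F, hF⟩ := h.exists_isBowlHeight
  exact ⟨F, P, P', hF⟩

/-! ### Strict barriers -/

/-- The quadratic decreases in each variable on `a, b ≥ 2/3`, so it is largest at `a = b = m`. -/
theorem quadratic_le_of_le {m a b : ℝ} (hm : 2 ≤ 3 * m) (ha : m ≤ a) (hb : m ≤ b) :
    2 * (a + b) - (a ^ 2 + a * b + b ^ 2) ≤ 4 * m - 3 * m ^ 2 := by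
  nlinarith [mul_nonneg (sub_nonneg.2 ha) (sub_nonneg.2 hb), sq_nonneg (a - m), sq_nonneg (b - m),
    mul_nonneg (sub_nonneg.2 hm) (sub_nonneg.2 ha), mul_nonneg (sub_nonneg.2 hm) (sub_nonneg.2 hb)]

/-- The lower bound for `a` and `b` increases with `s`, so its value at the left end of an interval
serves on the whole interval. Cutting at `1.7` and `2.2` suffices: beyond `2.2` the bound exceeds
`4/3`, where `4 m - 3 m² ≤ 0`. -/
theorem barrier_estimate {s a b : ℝ} (hs : 1 ≤ s) (ha : 2 * s / (s + 1) - 1 / (100 * s) ≤ a)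
    (hb : 2 * s / (s + 1) - 1 / (100 * s) ≤ b) :
    (s ^ 2 - 1) * (2 * (a + b) - (a ^ 2 + a * b + b ^ 2)) < 2 := by
  have key : ∀ m c : ℝ, 2 ≤ 3 * m → m ≤ 2 * s / (s + 1) - 1 / (100 * s) →
      4 * m - 3 * m ^ 2 ≤ c → (s ^ 2 - 1) * c < 2 →
      (s ^ 2 - 1) * (2 * (a + b) - (a ^ 2 + a * b + b ^ 2)) < 2 := fun m c hm h hc hlt =>
    (mul_le_mul_of_nonneg_left ((quadratic_le_of_le hm (h.trans ha) (h.trans hb)).trans hc)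
      (by nlinarith)).trans_lt hlt
  have hm : ∀ t : ℝ, 1 ≤ t → t ≤ s →
      2 * t / (t + 1) - 1 / (100 * t) ≤ 2 * s / (s + 1) - 1 / (100 * s) := fun t ht hts => by
    have h1 : 1 / (100 * s) ≤ 1 / (100 * t) := by gcongr
    have h2 : 2 * t / (t + 1) ≤ 2 * s / (s + 1) := by
      rw [div_le_div_iff₀ (by linarith) (by linarith)]
      nlinarith
    linarith
  rcases le_total s (17 / 10) with h1 | h1
  · exact key (99 / 100) (102 / 100) (by norm_num) ((by norm_num : _ ≤ _).trans (hm 1 le_rfl hs))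
      (by norm_num) (by nlinarith)
  rcases le_total s (22 / 10) with h2 | h2
  · exact key (125 / 100) (1 / 2) (by norm_num)
      ((by norm_num : _ ≤ _).trans (hm (17 / 10) (by norm_num) h1)) (by norm_num) (by nlinarith)
  · exact key (4 / 3) 0 (by norm_num)
      ((by norm_num : _ ≤ _).trans (hm (22 / 10) (by norm_num) h2)) (by norm_num) (by norm_num)

/-- The functions `F + τ / s` are strict upper (`τ > 0`) and lower (`τ < 0`) barriers. -/
theorem IsBowlSlope.barrier {P P' : ℝ → ℝ} (h : IsBowlSlope P P') {τ : ℝ} (hτ : |τ| ≤ 1 / 100)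
    (hτ0 : τ ≠ 0) {s : ℝ} (hs : 1 ≤ s) :
    τ * ((s ^ 2 - 1) * (P' s + 2 * τ / s ^ 3) +
      s * (P s - τ / s ^ 2) * (2 + (P s - τ / s ^ 2) ^ 2 * (s ^ 2 - 1)) -
        2 * (1 + (P s - τ / s ^ 2) ^ 2 * (s ^ 2 - 1))) < 0 := by
  have hs0 : 0 < s := by linarith
  have hl := h.lower s hs
  have e := h.eqn s hs
  set p := P s
  set q := p - τ / s ^ 2 with hq
  have hp : 2 * s / (s + 1) ≤ s * p := by
    calc 2 * s / (s + 1) = s * (2 / (s + 1)) := by ring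
      _ ≤ _ := by gcongr
  have hsq : s * q = s * p - τ / s := by rw [hq]; field_simp
  have hτs : τ / s ≤ 1 / (100 * s) := by
    calc τ / s ≤ (1 / 100) / s := by gcongr; exact (le_abs_self τ).trans hτ
      _ = _ := by field_simp
  have h100 : 0 ≤ 1 / (100 * s) := by positivity
  have key := barrier_estimate hs (a := s * p) (b := s * q) (by linarith) (by linarith)
  -- Subtracting the equation for `p` from the expression for `q` leaves the factor `q - p = -τ /
  -- s²`; the linear terms combine to `-2 τ / s³`.
  have : τ * ((s ^ 2 - 1) * (P' s + 2 * τ / s ^ 3) + s * q * (2 + q ^ 2 * (s ^ 2 - 1)) -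
        2 * (1 + q ^ 2 * (s ^ 2 - 1))) = τ ^ 2 / s ^ 3 * ((s ^ 2 - 1) *
          (2 * (s * p + s * q) - ((s * p) ^ 2 + s * p * (s * q) + (s * q) ^ 2)) - 2) := by
    have e' : (s ^ 2 - 1) * P' s = 2 * (1 + p ^ 2 * (s ^ 2 - 1)) -
      s * p * (2 + p ^ 2 * (s ^ 2 - 1)) := by linarith
    rw [mul_add (s ^ 2 - 1), e', hq]
    field_simp
    ring
  rw [this]
  exact mul_neg_of_pos_of_neg (by positivity) (by linarith)

/-! ### Linear algebra at a point of tangency -/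

theorem trace_inv_mul_of_fin_two (g M : Matrix (Fin 2) (Fin 2) ℝ) :
    Matrix.trace (g⁻¹ * M) =
      (g 1 1 * M 0 0 - g 0 1 * M 1 0 - g 1 0 * M 0 1 + g 0 0 * M 1 1) /
        (g 0 0 * g 1 1 - g 0 1 * g 1 0) := by
  rw [Matrix.inv_def, Matrix.adjugate_fin_two, Matrix.det_fin_two, Ring.inverse_eq_inv']
  simp only [Matrix.trace_fin_two, Matrix.mul_apply, Fin.sum_univ_two, Matrix.smul_apply,
    Matrix.of_apply, Matrix.cons_val_zero, Matrix.cons_val_one, Matrix.cons_val', smul_eq_mul]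
  ring

/-- A vector tangent to `H2` at `x` and orthogonal to two tangent vectors with independent
projections to the plane vanishes. -/
theorem eq_zero_of_lor_eq_zero {x v w m : L3} (hx : x ∈ H2) (hv : lor x v = 0) (hw : lor x w = 0)
    (hm : lor x m = 0) (hd : v 0 * w 1 - v 1 * w 0 ≠ 0) (hvm : lor v m = 0) (hwm : lor w m = 0) :
    m = 0 := by
  obtain ⟨hx1, hx2⟩ := hx
  simp only [lor] at *
  have hs : x 2 ≠ 0 := hx2.ne'
  have h0 : (v 0 * w 1 - v 1 * w 0) * (x 2 * m 0 - x 0 * m 2) = 0 := by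
    linear_combination (x 2 * w 1) * hvm - (x 2 * v 1) * hwm + m 2 * (v 1 * hw - w 1 * hv)
  have h1 : (v 0 * w 1 - v 1 * w 0) * (x 2 * m 1 - x 1 * m 2) = 0 := by
    linear_combination (x 2 * v 0) * hwm - (x 2 * w 0) * hvm + m 2 * (w 0 * hv - v 0 * hw)
  replace h0 := (mul_eq_zero.1 h0).resolve_left hd
  replace h1 := (mul_eq_zero.1 h1).resolve_left hd
  have h2 : m 2 = 0 := by linear_combination m 2 * hx1 - x 2 * hm + x 0 * h0 + x 1 * h1
  have h3 : m 0 = 0 := by simpa [h2, hs] using h0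
  have h4 : m 1 = 0 := by simpa [h2, hs] using h1
  ext i
  fin_cases i <;> assumption

/-- The gradient of `z - F(x₃)` on `H2 × ℝ` at a point over `x`, where `p = F'(x₃)`. -/
def graphNormal (p : ℝ) (x : L3) : L3 × ℝ :=
  (![-(p * x 2 * x 0), -(p * x 2 * x 1), -(p * (x 2 ^ 2 - 1))], 1)

theorem lor_graphNormal {p : ℝ} {x : L3} (hx : x ∈ H2) : lor x (graphNormal p x).1 = 0 := by
  have := hx.1
  simp only [lor, graphNormal] at *
  simp
  linear_combination (-p * x 2) * this

theorem amb_graphNormal {p : ℝ} {x : L3} (V : L3 × ℝ) :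
    amb V (graphNormal p x) = V.2 - p * V.1 2 - p * x 2 * lor x V.1 := by
  simp [amb, lor, graphNormal]
  ring

theorem amb_graphNormal_eq_zero {p : ℝ} {x : L3} {V : L3 × ℝ} (h : lor x V.1 = 0)
    (h' : V.2 = p * V.1 2) : amb V (graphNormal p x) = 0 := by
  rw [amb_graphNormal, h, h']
  ring

theorem amb_graphNormal_self {p : ℝ} {x : L3} (hx : x ∈ H2) :
    amb (graphNormal p x) (graphNormal p x) = 1 + p ^ 2 * (x 2 ^ 2 - 1) := by
  rw [amb_graphNormal, lor_graphNormal hx]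
  simp [graphNormal]
  ring

theorem lor_smul_right (c : ℝ) (x y : L3) : lor x (c • y) = c * lor x y := by
  simp [lor]
  ring

theorem lor_sub_right (x y z : L3) : lor x (y - z) = lor x y - lor x z := by
  simp [lor]
  ring

theorem amb_smul_right (c : ℝ) (x y : L3 × ℝ) : amb x (c • y) = c * amb x y := by
  simp [amb, lor]
  ring

theorem amb_smul_left (c : ℝ) (x y : L3 × ℝ) : amb (c • x) y = c * amb x y := by
  simp [amb, lor]
  ring

theorem amb_comm (x y : L3 × ℝ) : amb x y = amb y x := by
  simp [amb, lor]
  ring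

theorem one_le_of_mem_H2 {x : L3} (hx : x ∈ H2) : 1 ≤ x 2 := by
  obtain ⟨h1, h2⟩ := hx
  simp only [lor] at h1
  nlinarith [sq_nonneg (x 0), sq_nonneg (x 1)]

/-- A normal vector of a surface tangent to a level set of `z - F(x₃)` is a multiple of the
gradient of this function. -/
theorem eq_smul_graphNormal {p : ℝ} {x : L3} {V W n : L3 × ℝ} (hx : x ∈ H2)
    (hV : lor x V.1 = 0) (hW : lor x W.1 = 0) (hd : V.1 0 * W.1 1 - V.1 1 * W.1 0 ≠ 0)
    (hV2 : V.2 = p * V.1 2) (hW2 : W.2 = p * W.1 2) (hn : lor x n.1 = 0)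
    (hVn : amb V n = 0) (hWn : amb W n = 0) : n = n.2 • graphNormal p x := by
  have hV' := amb_graphNormal_eq_zero hV hV2
  have hW' := amb_graphNormal_eq_zero hW hW2
  have h1 : (graphNormal p x).2 = 1 := rfl
  have key : n.1 - n.2 • (graphNormal p x).1 = 0 := by
    refine eq_zero_of_lor_eq_zero hx hV hW ?_ hd ?_ ?_
    · rw [lor_sub_right, lor_smul_right, hn, lor_graphNormal hx]
      ring
    · rw [lor_sub_right, lor_smul_right]
      simp only [amb, h1] at hVn hV'
      linear_combination hVn - n.2 * hV'
    · rw [lor_sub_right, lor_smul_right]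
      simp only [amb, h1] at hWn hW'
      linear_combination hWn - n.2 * hW'
  ext1
  · exact sub_eq_zero.1 key
  · simp [h1]

/-- The comparison of the trace of the second fundamental form in the direction of the gradient
of `z - F(x₃)` with the corresponding expression for the graph of `F(x₃)`. Here `p = F'(x₃)`,
`p' = F''(x₃)`, the vectors `V`, `W` span the tangent plane and the `Y`s are the second
derivatives of the immersion. -/
theorem trace_comparison {p p' σ : ℝ} {x : L3} {V W Y11 Y12 Y22 : L3 × ℝ} (hx : x ∈ H2)
    (hV : lor x V.1 = 0) (hW : lor x W.1 = 0) (hd : V.1 0 * W.1 1 - V.1 1 * W.1 0 ≠ 0)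
    (hV2 : V.2 = p * V.1 2) (hW2 : W.2 = p * W.1 2)
    (h11 : lor x Y11.1 = -lor V.1 V.1) (h12 : lor x Y12.1 = -lor V.1 W.1)
    (h22 : lor x Y22.1 = -lor W.1 W.1)
    (hq : ∀ a b : ℝ, σ * (a ^ 2 * (Y11.2 - p' * V.1 2 ^ 2 - p * Y11.1 2) +
      2 * a * b * (Y12.2 - p' * (V.1 2 * W.1 2) - p * Y12.1 2) +
      b ^ 2 * (Y22.2 - p' * W.1 2 ^ 2 - p * Y22.1 2)) ≤ 0) :
    σ * ((amb W W * amb Y11 (graphNormal p x) - 2 * amb V W * amb Y12 (graphNormal p x) +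
      amb V V * amb Y22 (graphNormal p x)) / (amb V V * amb W W - amb V W * amb V W) *
        (1 + p ^ 2 * (x 2 ^ 2 - 1))) ≤
      σ * (p' * (x 2 ^ 2 - 1) + x 2 * p * (2 + p ^ 2 * (x 2 ^ 2 - 1))) := by
  rw [amb_graphNormal, amb_graphNormal, amb_graphNormal, h11, h12, h22]
  -- The `q`s are the second derivatives of `z - F(x₃)` along the immersion; `σ` times this form is
  -- negative semidefinite.
  generalize hq11 : Y11.2 - p' * V.1 2 ^ 2 - p * Y11.1 2 = q11 at hq
  generalize hq12 : Y12.2 - p' * (V.1 2 * W.1 2) - p * Y12.1 2 = q12 at hq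
  generalize hq22 : Y22.2 - p' * W.1 2 ^ 2 - p * Y22.1 2 = q22 at hq
  rw [show Y11.2 - p * Y11.1 2 = q11 + p' * V.1 2 ^ 2 by linarith,
    show Y12.2 - p * Y12.1 2 = q12 + p' * (V.1 2 * W.1 2) by linarith,
    show Y22.2 - p * Y22.1 2 = q22 + p' * W.1 2 ^ 2 by linarith]
  obtain ⟨hx1, hx2⟩ := hx
  simp only [amb, hV2, hW2]
  simp only [lor] at *
  generalize V.1 0 = a0 at *
  generalize V.1 1 = a1 at *
  generalize V.1 2 = a2 at *
  generalize W.1 0 = b0 at *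
  generalize W.1 1 = b1 at *
  generalize W.1 2 = b2 at *
  generalize x 2 = s at *
  generalize x 0 = x0 at *
  generalize x 1 = x1 at *
  have hs2 : 0 < s ^ 2 := by positivity
  have ha : a2 = (x0 * a0 + x1 * a1) / s := by field_simp; linarith
  have hb : b2 = (x0 * b0 + x1 * b1) / s := by field_simp; linarith
  set ℓ11 := a0 * a0 + a1 * a1 - a2 * a2 with hℓ11
  set ℓ12 := a0 * b0 + a1 * b1 - a2 * b2 with hℓ12
  set ℓ22 := b0 * b0 + b1 * b1 - b2 * b2 with hℓ22
  have hsx : x0 ^ 2 = s ^ 2 - 1 - x1 ^ 2 := by linarith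
  have e11 : ℓ11 = ((a0 ^ 2 + a1 ^ 2) + (x0 * a1 - x1 * a0) ^ 2) / s ^ 2 := by
    rw [hℓ11, ha]
    field_simp
    linear_combination (-(a0 ^ 2 + a1 ^ 2)) * hsx
  have hℓpos : 0 < ℓ11 := by
    rw [e11]
    have : 0 < a0 ^ 2 + a1 ^ 2 := by
      by_contra h
      have h0 : a0 = 0 := pow_eq_zero_iff two_ne_zero |>.1 <|
        le_antisymm (by linarith only [h, sq_nonneg a1]) (sq_nonneg a0)
      have h1 : a1 = 0 := pow_eq_zero_iff two_ne_zero |>.1 <|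
        le_antisymm (by linarith only [h, sq_nonneg a0]) (sq_nonneg a1)
      exact hd (by rw [h0, h1]; ring)
    positivity
  have eΔ : ℓ11 * ℓ22 - ℓ12 * ℓ12 = (a0 * b1 - a1 * b0) ^ 2 / s ^ 2 := by
    rw [hℓ11, hℓ12, hℓ22, ha, hb]
    field_simp
    linear_combination (-(a0 * b1 - a1 * b0) ^ 2 * s ^ 2) * hsx
  have hΔ : 0 < ℓ11 * ℓ22 - ℓ12 * ℓ12 := by rw [eΔ]; positivity
  -- This is `|∇x₃|² = s² - 1` on the hyperbolic plane, multiplied by the Gram determinant.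
  have eD : ℓ22 * a2 ^ 2 - 2 * ℓ12 * (a2 * b2) + ℓ11 * b2 ^ 2 =
      (s ^ 2 - 1) * (ℓ11 * ℓ22 - ℓ12 * ℓ12) := by
    rw [eΔ, hℓ11, hℓ12, hℓ22, ha, hb]
    field_simp
    linear_combination ((a0 * b1 - a1 * b0) ^ 2 * s ^ 2) * hsx
  clear_value ℓ11 ℓ12 ℓ22
  have hW2 : 0 < 1 + p ^ 2 * (s ^ 2 - 1) := by
    have : 0 ≤ s ^ 2 - 1 := by nlinarith [sq_nonneg x0, sq_nonneg x1]
    positivity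
  have hdet : (ℓ11 + p * a2 * (p * a2)) * (ℓ22 + p * b2 * (p * b2)) -
      (ℓ12 + p * a2 * (p * b2)) * (ℓ12 + p * a2 * (p * b2)) =
      (1 + p ^ 2 * (s ^ 2 - 1)) * (ℓ11 * ℓ22 - ℓ12 * ℓ12) := by
    linear_combination p ^ 2 * eD
  have hg11 : 0 < ℓ11 + p * a2 * (p * a2) := 
    add_pos_of_pos_of_nonneg hℓpos (mul_self_nonneg _)
  rw [hdet]
  set Δ := ℓ11 * ℓ22 - ℓ12 * ℓ12 with hΔdef
  set g11 := ℓ11 + p * a2 * (p * a2) with hg11def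
  set g12 := ℓ12 + p * a2 * (p * b2) with hg12def
  set g22 := ℓ22 + p * b2 * (p * b2) with hg22def
  clear_value Δ g11 g12 g22
  have hdet' : 0 < g11 * g22 - g12 * g12 := by rw [hdet]; positivity
  -- The trace of a semidefinite form against a positive definite metric has a sign: up to positive
  -- factors it is the sum of the values of the form at `(1, 0)` and `(-g12, g11)`.
  have hqq : σ * (g22 * q11 - 2 * g12 * q12 + g11 * q22) ≤ 0 := by
    have h1 := mul_le_mul_of_nonneg_left (hq 1 0) hdet'.le
    have h2 := hq (-g12) g11
    have h3 : g11 * (σ * (g22 * q11 - 2 * g12 * q12 + g11 * q22)) =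
        (g11 * g22 - g12 * g12) * (σ * (1 ^ 2 * q11 + 2 * 1 * 0 * q12 + 0 ^ 2 * q22)) +
          σ * ((-g12) ^ 2 * q11 + 2 * -g12 * g11 * q12 + g11 ^ 2 * q22) := by ring
    refine nonpos_of_mul_nonpos_right ?_ hg11
    rw [h3]
    linarith
  have hfin : g22 * (q11 + p' * a2 ^ 2 - p * s * -ℓ11) -
      2 * g12 * (q12 + p' * (a2 * b2) - p * s * -ℓ12) +
      g11 * (q22 + p' * b2 ^ 2 - p * s * -ℓ22) = (g22 * q11 - 2 * g12 * q12 + g11 * q22) +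
      Δ * (p' * (s ^ 2 - 1) + s * p * (2 + p ^ 2 * (s ^ 2 - 1))) := by
    rw [hg11def, hg12def, hg22def, hΔdef]
    linear_combination (p' + p ^ 3 * s) * (eD + (s ^ 2 - 1) * hΔdef)
  rw [hfin]
  have : σ * ((g22 * q11 - 2 * g12 * q12 + g11 * q22 +
      Δ * (p' * (s ^ 2 - 1) + s * p * (2 + p ^ 2 * (s ^ 2 - 1)))) /
      ((1 + p ^ 2 * (s ^ 2 - 1)) * Δ) * (1 + p ^ 2 * (s ^ 2 - 1))) =
      σ * (g22 * q11 - 2 * g12 * q12 + g11 * q22) / Δ +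
      σ * (p' * (s ^ 2 - 1) + s * p * (2 + p ^ 2 * (s ^ 2 - 1))) := by
    have := hW2.ne'
    have := hΔ.ne'
    generalize 1 + p ^ 2 * (s ^ 2 - 1) = w at *
    generalize p' * (s ^ 2 - 1) + s * p * (2 + p ^ 2 * (s ^ 2 - 1)) = E
    field_simp
  rw [this]
  have := div_nonpos_of_nonpos_of_nonneg hqq hΔ.le
  linarith

/-! ### First and second derivatives along curves -/

/-- A positive second derivative would make the point also a local minimum, so `f` would be locally
constant and its second derivative zero. -/
theorem IsLocalMax.second_deriv_nonpos {f f' : ℝ → ℝ} {a x : ℝ} (h : IsLocalMax f x)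
    (hf : ∀ᶠ t in 𝓝 x, HasDerivAt f (f' t) t) (hf' : HasDerivAt f' a x) : a ≤ 0 := by
  by_contra! ha
  have e : deriv f =ᶠ[𝓝 x] f' := hf.mono fun t ht => ht.deriv
  have e2 : deriv (deriv f) x = a := e.deriv_eq.trans hf'.deriv
  have hmin : IsLocalMin f x := isLocalMin_of_deriv_deriv_pos (e2 ▸ ha) h.deriv_eq_zero
    hf.self_of_nhds.continuousAt
  have hc : f =ᶠ[𝓝 x] fun _ => f x := by
    filter_upwards [h, hmin] with t h1 h2 using le_antisymm h1 h2
  have : deriv (deriv f) x = 0 := by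
    rw [hc.deriv.deriv_eq]
    simp
  linarith

theorem hasDerivAt_coord {c : ℝ → L3 × ℝ} {v : L3 × ℝ} {t : ℝ} (h : HasDerivAt c v t) (i : Fin 3) :
    HasDerivAt (fun t => (c t).1 i) (v.1 i) t :=
  (hasDerivAt_pi.1 h.fst) i

theorem hasDerivAt_height {c : ℝ → L3 × ℝ} {v : L3 × ℝ} {t : ℝ} (h : HasDerivAt c v t) :
    HasDerivAt (fun t => (c t).2) v.2 t :=
  h.snd

theorem hasDerivAt_lor {c d : ℝ → L3 × ℝ} {v w : L3 × ℝ} {t : ℝ} (hc : HasDerivAt c v t)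
    (hd : HasDerivAt d w t) :
    HasDerivAt (fun t => lor (c t).1 (d t).1) (lor v.1 (d t).1 + lor (c t).1 w.1) t := by
  unfold lor
  refine ((((hasDerivAt_coord hc 0).mul (hasDerivAt_coord hd 0)).add
    ((hasDerivAt_coord hc 1).mul (hasDerivAt_coord hd 1))).sub
    ((hasDerivAt_coord hc 2).mul (hasDerivAt_coord hd 2))).congr_deriv ?_
  ring

theorem lor_comm (x y : L3) : lor x y = lor y x := by
  simp [lor]
  ring

/-- Differentiate `lor c c = -1` twice. -/
theorem lor_curve {c c' : ℝ → L3 × ℝ} {y : L3 × ℝ} (hc : ∀ᶠ t in 𝓝 0, HasDerivAt c (c' t) t)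
    (hc' : HasDerivAt c' y 0) (hH : ∀ t, (c t).1 ∈ H2) :
    lor (c 0).1 (c' 0).1 = 0 ∧ lor (c 0).1 y.1 = -lor (c' 0).1 (c' 0).1 := by
  have h0 : ∀ᶠ t in 𝓝 0, lor (c t).1 (c' t).1 = 0 := by
    filter_upwards [hc] with t ht
    have h1 := hasDerivAt_lor ht ht
    have h2 : HasDerivAt (fun t => lor (c t).1 (c t).1) 0 t := by
      simp only [(hH _).1]
      exact hasDerivAt_const _ _
    have := h1.unique h2
    rw [lor_comm (c' t).1] at this
    linarith
  refine ⟨h0.self_of_nhds, ?_⟩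
  have h1 := hasDerivAt_lor hc.self_of_nhds hc'
  have h2 : HasDerivAt (fun t => lor (c t).1 (c' t).1) 0 0 :=
    (hasDerivAt_const 0 (0 : ℝ)).congr_of_eventuallyEq h0
  have := h1.unique h2
  linarith

theorem curve_touching {c c' : ℝ → L3 × ℝ} {y : L3 × ℝ} (hc : ∀ᶠ t in 𝓝 0, HasDerivAt c (c' t) t)
    (hc' : HasDerivAt c' y 0) {G P : ℝ → ℝ} {p' σ : ℝ}
    (hG : ∀ᶠ s in 𝓝 ((c 0).1 2), HasDerivAt G (P s) s) (hP : HasDerivAt P p' ((c 0).1 2))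
    (hmax : IsLocalMax (fun t => σ * ((c t).2 - G ((c t).1 2))) 0) :
    σ * ((c' 0).2 - P ((c 0).1 2) * (c' 0).1 2) = 0 ∧
      σ * (y.2 - p' * (c' 0).1 2 ^ 2 - P ((c 0).1 2) * y.1 2) ≤ 0 := by
  have h3 := hasDerivAt_coord hc.self_of_nhds 2
  have hd : ∀ᶠ t in 𝓝 0, HasDerivAt (fun t => σ * ((c t).2 - G ((c t).1 2)))
      (σ * ((c' t).2 - P ((c t).1 2) * (c' t).1 2)) t := by
    filter_upwards [hc, h3.continuousAt.eventually hG] with t ht hGt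
    exact ((hasDerivAt_height ht).sub (hGt.comp t (hasDerivAt_coord ht 2))).const_mul σ
  refine ⟨hmax.hasDerivAt_eq_zero hd.self_of_nhds, IsLocalMax.second_deriv_nonpos hmax hd ?_⟩
  refine (((hasDerivAt_height hc').sub ((hP.comp 0 h3).mul (hasDerivAt_coord hc' 2))).const_mul σ).congr_deriv ?_
  simp only [Function.comp]
  ring

theorem hasDerivAt_line {X : Plane → L3 × ℝ} {u : Plane} (hX : ContDiffAt ℝ ∞ X u) (ξ : Plane) :
    (∀ᶠ t in 𝓝 (0 : ℝ), HasDerivAt (fun t : ℝ => X (u + t • ξ)) (fderiv ℝ X (u + t • ξ) ξ) t) ∧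
      HasDerivAt (fun t : ℝ => fderiv ℝ X (u + t • ξ) ξ) (fderiv ℝ (fderiv ℝ X) u ξ ξ) 0 := by
  have hl : ∀ t : ℝ, HasDerivAt (fun t : ℝ => u + t • ξ) ξ t := fun t => by
    simpa using ((hasDerivAt_id t).smul_const ξ).const_add u
  have h1 : ∀ᶠ v in 𝓝 u, DifferentiableAt ℝ X v :=
    ((hX.of_le (by norm_num : (1 : WithTop ℕ∞) ≤ ∞)).eventually (by simp)).mono
      fun v hv => hv.differentiableAt one_ne_zero
  have h2 : Tendsto (fun t : ℝ => u + t • ξ) (𝓝 0) (𝓝 u) := by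
    simpa using (hl 0).continuousAt.tendsto
  refine ⟨(h2.eventually h1).mono fun t ht => ht.hasFDerivAt.comp_hasDerivAt t (hl t), ?_⟩
  have h3 : DifferentiableAt ℝ (fderiv ℝ X) u :=
    (hX.fderiv_right (m := ∞) (by simp)).differentiableAt (by simp)
  have h4 : HasFDerivAt (fderiv ℝ X) (fderiv ℝ (fderiv ℝ X) u) (u + (0 : ℝ) • ξ) := by
    simpa using h3.hasFDerivAt
  have h5 := h4.comp_hasDerivAt 0 (hl 0)
  exact ((ContinuousLinearMap.apply ℝ (L3 × ℝ) ξ).hasFDerivAt (x := _)).comp_hasDerivAt 0 h5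

theorem partialD_partialD {X : Plane → L3 × ℝ} {u : Plane} (hX : ContDiffAt ℝ ∞ X u) (i j : Fin 2) :
    partialD i (partialD j X) u = fderiv ℝ (fderiv ℝ X) u (EuclideanSpace.single i 1)
      (EuclideanSpace.single j 1) := by
  have h3 : DifferentiableAt ℝ (fderiv ℝ X) u :=
    (hX.fderiv_right (m := ∞) (by simp)).differentiableAt (by simp)
  have h4 : HasFDerivAt (partialD j X) _ u :=
    ((ContinuousLinearMap.apply ℝ (L3 × ℝ) (EuclideanSpace.single j (1 : ℝ))).hasFDerivAt
      (x := fderiv ℝ X u)).comp u h3.hasFDerivAt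
  unfold partialD at h4 ⊢
  rw [h4.fderiv]
  rfl

/-! ### Curvature comparison at a point of tangency -/

section Surface

variable {S : Type*} [TopologicalSpace S] [ChartedSpace Plane S]

theorem IsImmersedSurface.contDiffAt_localParam {ψ : S → L3 × ℝ} (h : IsImmersedSurface ψ) (p : S) :
    ContDiffAt ℝ ∞ (localParam ψ p) (extChartAt 𝓘(ℝ, Plane) p p) := by
  have : ContDiffWithinAt ℝ ∞ (localParam ψ p) (range 𝓘(ℝ, Plane))
    (extChartAt 𝓘(ℝ, Plane) p p) := (contMDiffAt_iff.1 (h.smooth p)).2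
  rwa [ModelWithCorners.range_eq_univ, contDiffWithinAt_univ] at this

theorem IsImmersedSurface.mfderiv_eq {ψ : S → L3 × ℝ} (h : IsImmersedSurface ψ) (p : S) :
    mfderiv 𝓘(ℝ, Plane) 𝓘(ℝ, L3 × ℝ) ψ p =
      fderiv ℝ (localParam ψ p) (extChartAt 𝓘(ℝ, Plane) p p) := by
  have hd := (h.smooth p).mdifferentiableAt (by simp)
  refine hd.mfderiv.trans ?_
  change fderivWithin ℝ (localParam ψ p) (range 𝓘(ℝ, Plane)) _ = _
  rw [ModelWithCorners.range_eq_univ, fderivWithin_univ]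

end Surface

theorem clm_apply_plane {E : Type*} [NormedAddCommGroup E] [NormedSpace ℝ E] (A : Plane →L[ℝ] E)
    (a b : ℝ) : A (a • EuclideanSpace.single 0 1 + b • EuclideanSpace.single 1 1) =
      a • A (EuclideanSpace.single 0 1) + b • A (EuclideanSpace.single 1 1) := by
  simp

theorem eq_zero_of_tangent {x v : L3} (hx : x ∈ H2) (hv : lor x v = 0) (h0 : v 0 = 0)
    (h1 : v 1 = 0) : v = 0 := by
  have h2 : x 2 * v 2 = 0 := by
    simp only [lor, h0, h1] at hv
    linarith
  have h3 : v 2 = 0 := (mul_eq_zero.1 h2).resolve_left hx.2.ne'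
  ext i
  fin_cases i <;> assumption

/-- The planar projections of two tangent vectors spanning a plane on which `dz = p dx₃` are
independent. -/
theorem planar_det_ne_zero {A : Plane →L[ℝ] L3 × ℝ} (hA : Function.Injective A) {x : L3}
    (hx : x ∈ H2) {p : ℝ} (htan : ∀ ξ, lor x (A ξ).1 = 0) (hgrad : ∀ ξ, (A ξ).2 = p * (A ξ).1 2) :
    (A (EuclideanSpace.single 0 1)).1 0 * (A (EuclideanSpace.single 1 1)).1 1 -
      (A (EuclideanSpace.single 0 1)).1 1 * (A (EuclideanSpace.single 1 1)).1 0 ≠ 0 := by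
  intro h
  have key : ∀ ξ, (A ξ).1 0 = 0 → (A ξ).1 1 = 0 → ξ = 0 := fun ξ h0 h1 => by
    have h2 := eq_zero_of_tangent hx (htan ξ) h0 h1
    refine hA ?_
    rw [map_zero]
    ext1
    · exact h2
    · rw [hgrad, h2]
      simp
  set V := A (EuclideanSpace.single 0 1) with hV
  set W := A (EuclideanSpace.single 1 1) with hW
  have hlin : ∀ a b : ℝ, a * V.1 0 + b * W.1 0 = 0 → a * V.1 1 + b * W.1 1 = 0 →
      a = 0 ∧ b = 0 := fun a b h0 h1 => by
    have := key (a • EuclideanSpace.single 0 1 + b • EuclideanSpace.single 1 1)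
      (by rw [clm_apply_plane]; simpa using h0) (by rw [clm_apply_plane]; simpa using h1)
    constructor
    · simpa using congrArg (fun u : Plane => u 0) this
    · simpa using congrArg (fun u : Plane => u 1) this
  have h1 := hlin (W.1 0) (-V.1 0) (by ring) (by linarith)
  have h2 := hlin (W.1 1) (-V.1 1) (by linarith) (by ring)
  have h3 := hlin 1 0 (by linarith [h1.2]) (by linarith [h2.2])
  exact one_ne_zero h3.1

/-- The curvature comparison at a point where the surface touches the graph of `G(x₃)` up to a
translation: from below if `σ > 0`, from above if `σ < 0`. -/
theorem IsImmersedSurface.touching {S : Type*} [TopologicalSpace S] [ChartedSpace Plane S]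
    {ψ η : S → L3 × ℝ} (hψ : IsImmersedSurface ψ) (hη : IsUnitNormal ψ η) {p : S}
    {G P : ℝ → ℝ} {p' σ : ℝ} (hσ : σ ≠ 0)
    (hG : ∀ᶠ s in 𝓝 ((ψ p).1 2), HasDerivAt G (P s) s) (hP : HasDerivAt P p' ((ψ p).1 2))
    (hmax : IsLocalMax (fun q => σ * ((ψ q).2 - G ((ψ q).1 2))) p) :
    (η p).2 ^ 2 * (1 + P ((ψ p).1 2) ^ 2 * ((ψ p).1 2 ^ 2 - 1)) = 1 ∧
    ∃ T : ℝ, 2 * meanCurvature ψ p (η p) = (η p).2 * T ∧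
      σ * (T * (1 + P ((ψ p).1 2) ^ 2 * ((ψ p).1 2 ^ 2 - 1))) ≤
        σ * (p' * ((ψ p).1 2 ^ 2 - 1) +
          (ψ p).1 2 * P ((ψ p).1 2) * (2 + P ((ψ p).1 2) ^ 2 * ((ψ p).1 2 ^ 2 - 1))) := by
  have hX := hψ.contDiffAt_localParam p
  have hinj := hψ.immersion p
  have hnor := hη.normal p
  rw [hψ.mfderiv_eq p] at hinj hnor
  have htan := hη.tangent p
  have hunit := hη.unit p
  have hXp : localParam ψ p (extChartAt 𝓘(ℝ, Plane) p p) = ψ p := by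
    simp [localParam]
  have hXH : ∀ u, (localParam ψ p u).1 ∈ H2 := fun u => hψ.mem_H2 _
  have hmaxX : IsLocalMax (fun u => σ * ((localParam ψ p u).2 - G ((localParam ψ p u).1 2)))
      (extChartAt 𝓘(ℝ, Plane) p p) := by
    have hc : Tendsto (extChartAt 𝓘(ℝ, Plane) p).symm (𝓝 (extChartAt 𝓘(ℝ, Plane) p p)) (𝓝 p) := by
      have := continuousAt_extChartAt_symm (I := 𝓘(ℝ, Plane)) p
      rwa [ContinuousAt, extChartAt_to_inv] at this
    have := hc.eventually hmax
    simpa [IsLocalMax, IsMaxFilter, localParam] using this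
  have hII : ∀ i j, secondForm ψ p (η p) i j = amb (fderiv ℝ (fderiv ℝ (localParam ψ p))
      (extChartAt 𝓘(ℝ, Plane) p p) (EuclideanSpace.single i 1) (EuclideanSpace.single j 1)) (η p) :=
    fun i j => by rw [secondForm, Matrix.of_apply, partialD_partialD hX]
  have hI : ∀ i j, firstForm ψ p i j = amb (fderiv ℝ (localParam ψ p)
      (extChartAt 𝓘(ℝ, Plane) p p) (EuclideanSpace.single i 1)) (fderiv ℝ (localParam ψ p)
      (extChartAt 𝓘(ℝ, Plane) p p) (EuclideanSpace.single j 1)) :=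
    fun i j => by simp [firstForm, partialD]
  have hsymm : ∀ ξ ζ, fderiv ℝ (fderiv ℝ (localParam ψ p)) (extChartAt 𝓘(ℝ, Plane) p p) ξ ζ =
      fderiv ℝ (fderiv ℝ (localParam ψ p)) (extChartAt 𝓘(ℝ, Plane) p p) ζ ξ :=
    fun ξ ζ => hX.isSymmSndFDerivAt (by
      rw [minSmoothness_of_isRCLikeNormedField]
      exact WithTop.coe_le_coe.2 (le_top : (2 : ℕ∞) ≤ ⊤)) ξ ζ
  rw [meanCurvature, trace_inv_mul_of_fin_two]
  simp only [hII, hI]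
  rw [← hXp] at hG hP htan ⊢
  generalize localParam ψ p = X at *
  generalize extChartAt 𝓘(ℝ, Plane) p p = u at *
  generalize η p = n at *
  have hcurve : ∀ ξ, (lor (X u).1 (fderiv ℝ X u ξ).1 = 0 ∧
      lor (X u).1 (fderiv ℝ (fderiv ℝ X) u ξ ξ).1 =
        -lor (fderiv ℝ X u ξ).1 (fderiv ℝ X u ξ).1) ∧
      σ * ((fderiv ℝ X u ξ).2 - P ((X u).1 2) * (fderiv ℝ X u ξ).1 2) = 0 ∧
      σ * ((fderiv ℝ (fderiv ℝ X) u ξ ξ).2 - p' * (fderiv ℝ X u ξ).1 2 ^ 2 -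
        P ((X u).1 2) * (fderiv ℝ (fderiv ℝ X) u ξ ξ).1 2) ≤ 0 := fun ξ => by
    obtain ⟨h1, h2⟩ := hasDerivAt_line hX ξ
    have e : u + (0 : ℝ) • ξ = u := by simp
    have h3 := lor_curve h1 h2 fun t => hXH _
    have hc : Tendsto (fun t : ℝ => u + t • ξ) (𝓝 0) (𝓝 u) := by
      have : Continuous fun t : ℝ => u + t • ξ := by fun_prop
      simpa using this.tendsto 0
    have h4 := curve_touching (G := G) (P := P) (p' := p') (σ := σ) h1 h2 (by rwa [e])
      (by rwa [e]) (by
        have := hc.eventually hmaxX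
        simpa [IsLocalMax, IsMaxFilter] using this)
    rw [e] at h3 h4
    exact ⟨h3, h4⟩
  generalize fderiv ℝ X u = A at *
  generalize fderiv ℝ (fderiv ℝ X) u = B at *
  generalize hx : (X u).1 = x at *
  have hxH : x ∈ H2 := hx ▸ hXH u
  have hgrad : ∀ ξ, (A ξ).2 = P (x 2) * (A ξ).1 2 := fun ξ =>
    sub_eq_zero.1 ((mul_eq_zero.1 (hcurve ξ).2.1).resolve_left hσ)
  have hd := planar_det_ne_zero hinj hxH (fun ξ => (hcurve ξ).1.1) hgrad
  have hB : ∀ a b : ℝ, B (a • EuclideanSpace.single 0 1 + b • EuclideanSpace.single 1 1)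
      (a • EuclideanSpace.single 0 1 + b • EuclideanSpace.single 1 1) =
      a ^ 2 • B (EuclideanSpace.single 0 1) (EuclideanSpace.single 0 1) +
      (2 * a * b) • B (EuclideanSpace.single 0 1) (EuclideanSpace.single 1 1) +
      b ^ 2 • B (EuclideanSpace.single 1 1) (EuclideanSpace.single 1 1) := fun a b => by
    simp only [map_add, map_smul, add_apply, smul_apply]
    rw [hsymm (EuclideanSpace.single 1 1) (EuclideanSpace.single 0 1)]
    module
  have hAab := clm_apply_plane A
  -- Polarisation: the direction `e₁ + e₂` gives the mixed identity `h12`.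
  have hpol := (hcurve ((1 : ℝ) • EuclideanSpace.single 0 1 + (1 : ℝ) • EuclideanSpace.single 1 1)).1.2
  rw [hB, hAab] at hpol
  have h11 := (hcurve (EuclideanSpace.single 0 1)).1.2
  have h22 := (hcurve (EuclideanSpace.single 1 1)).1.2
  have hq : ∀ a b : ℝ, _ := fun a b =>
    (hcurve (a • EuclideanSpace.single 0 1 + b • EuclideanSpace.single 1 1)).2.2
  simp only [hB, hAab] at hq
  have hn := eq_smul_graphNormal hxH (hcurve _).1.1 (hcurve _).1.1 hd (hgrad _) (hgrad _) htan
    (hnor _) (hnor _)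
  have hV := (hcurve (EuclideanSpace.single 0 1)).1.1
  have hW := (hcurve (EuclideanSpace.single 1 1)).1.1
  have hV2 := hgrad (EuclideanSpace.single 0 1)
  have hW2 := hgrad (EuclideanSpace.single 1 1)
  rw [hsymm (EuclideanSpace.single 1 1) (EuclideanSpace.single 0 1)]
  generalize A (EuclideanSpace.single 0 1) = V at *
  generalize A (EuclideanSpace.single 1 1) = W at *
  generalize B (EuclideanSpace.single 0 1) (EuclideanSpace.single 0 1) = Y11 at *
  generalize B (EuclideanSpace.single 0 1) (EuclideanSpace.single 1 1) = Y12 at *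
  generalize B (EuclideanSpace.single 1 1) (EuclideanSpace.single 1 1) = Y22 at *
  have h12 : lor x Y12.1 = -lor V.1 W.1 := by
    simp [lor] at hpol h11 h22 ⊢
    linarith
  refine ⟨?_, _, ?_, trace_comparison (σ := σ) (p' := p') hxH hV hW hd hV2 hW2 h11 h12 h22
    fun a b => ?_⟩
  · rw [← amb_graphNormal_self hxH, ← hunit]
    have e : amb n n = amb (n.2 • graphNormal (P (x 2)) x) (n.2 • graphNormal (P (x 2)) x) := by
      rw [← hn]
    rw [e, amb_smul_left, amb_smul_right]
    ring
  · have hY : ∀ Y, amb Y n = n.2 * amb Y (graphNormal (P (x 2)) x) := fun Y => by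
      nth_rewrite 1 [hn]
      rw [amb_smul_right]
    rw [hY Y11, hY Y12, hY Y22, amb_comm W V]
    ring
  · refine le_of_eq_of_le ?_ (hq a b)
    congr 1
    simp
    ring

/-! ### Maximum principle for translating solitons -/

theorem amb_dz (v : L3 × ℝ) : amb v dz = v.2 := by
  simp [amb, dz, lor]

/-- At such a maximum the surface is tangent to the graph of `F + τ / s`, so its normal is not
horizontal, and `H = ⟨η, ∂_z⟩` forces the normalised trace `T` to be `2`. The curvature comparison
then contradicts the strict barrier inequality. -/
theorem IsTranslatingSoliton.not_isLocalMax {S : Type*} [TopologicalSpace S] [ChartedSpace Plane S]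
    {ψ : S → L3 × ℝ} (hψ : IsTranslatingSoliton ψ) {F P P' : ℝ → ℝ} (hF : IsBowlHeight F P P')
    {τ : ℝ} (hτ : |τ| ≤ 1 / 100) (hτ0 : τ ≠ 0) (p : S) :
    ¬IsLocalMax (fun q => τ * ((ψ q).2 - (F ((ψ q).1 2) + τ * ((ψ q).1 2)⁻¹))) p := by
  intro hmax
  obtain ⟨himm, η, hη, hH⟩ := hψ
  have hs := one_le_of_mem_H2 (himm.mem_H2 p)
  have hs0 : (ψ p).1 2 ≠ 0 := by linarith
  obtain ⟨h1, T, hT, hle⟩ := himm.touching hη (G := fun s => F s + τ * s⁻¹)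
    (P := fun s => P s - τ / s ^ 2) (p' := P' ((ψ p).1 2) + 2 * τ / (ψ p).1 2 ^ 3) hτ0
    (by
      filter_upwards [isOpen_ne.mem_nhds hs0] with s hs
      exact ((hF.deriv s).add ((hasDerivAt_inv hs).const_mul τ)).congr_deriv (by ring))
    (by
      refine ((hF.slope.deriv _ hs).sub ((hasDerivAt_const _ τ).div (hasDerivAt_pow 2 _)
        (pow_ne_zero 2 hs0))).congr_deriv ?_
      field_simp
      ring) hmax
  rw [hH, amb_dz] at hT
  have hη0 : (η p).2 ≠ 0 := by
    intro h0
    simp [h0] at h1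
  have hT2 : T = 2 := by
    apply mul_left_cancel₀ hη0
    linarith
  have := hF.slope.barrier hτ hτ0 hs
  rw [hT2] at hle
  linarith

/-- Divide by `τ` and let `τ → 0` from either side. -/
theorem eq_zero_of_forall_mul_le_sq {a : ℝ}
    (h : ∀ τ : ℝ, |τ| ≤ 1 / 100 → τ ≠ 0 → τ * a ≤ τ ^ 2) : a = 0 := by
  have key : ∀ b : ℝ, (∀ τ : ℝ, 0 < τ → τ ≤ 1 / 100 → τ * b ≤ τ ^ 2) → b ≤ 0 := fun b hb => by
    refine le_of_forall_pos_le_add fun ε hε => ?_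
    have hpos : 0 < min ε (1 / 100) := by positivity
    have h1 := hb _ hpos (min_le_right _ _)
    rw [sq] at h1
    linarith [le_of_mul_le_mul_left h1 hpos, min_le_left ε (1 / 100)]
  refine le_antisymm (key a fun τ h0 h1 => h τ (by rwa [abs_of_pos h0]) h0.ne') ?_
  have := key (-a) fun τ h0 h1 => by
    have := h (-τ) (by rwa [abs_neg, abs_of_pos h0]) (neg_ne_zero.2 h0.ne')
    linarith
  linarith

theorem IsC1AsymptoticToBowl.tendsto {S : Type*} [TopologicalSpace S] {ψ : S → L3 × ℝ}
    (hH : ∀ p, (ψ p).1 ∈ H2) (hproper : IsProperMap ψ) (hasymp : IsC1AsymptoticToBowl (range ψ))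
    {F P P' : ℝ → ℝ} (hF : IsBowlHeight F P P') :
    Tendsto (fun p => (ψ p).2 - F ((ψ p).1 2)) (cocompact S) (𝓝 0) := by
  rw [Metric.tendsto_nhds]
  intro ε hε
  obtain ⟨R, hR, g, ⟨ρ, hρ⟩, hg, hgε, -⟩ := hasymp (ε / 2) (by positivity)
  obtain ⟨s₀, hs₀⟩ := eventually_atTop.1 ((Metric.tendsto_nhds.1 hF.tendsto) (ε / 2) (by positivity))
  set R' := max R (Real.arcosh (max s₀ 1))
  have hψ : Tendsto (fun p => ‖ψ p‖) (cocompact S) atTop :=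
    (tendsto_norm_cocompact_atTop (E := L3 × ℝ)).comp
      (isProperMap_iff_tendsto_cocompact.1 hproper).2
  -- Over `r ≤ R'` the image is bounded by this threshold: `cosh R'` bounds the hyperboloid
  -- coordinates, `|ρ|` the height over `r ≤ R`, and `2 R' + ε` the height where `R < r ≤ R'`. So
  -- points near infinity of `S` lie over `r > R'`.
  filter_upwards [hψ.eventually_gt_atTop (max (Real.cosh R') (max |ρ| (2 * R' + ε)))] with p hp
  have hx := hH p
  have hs := one_le_of_mem_H2 hx
  have hfar : R' < rad (ψ p).1 := by
    by_contra! hle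
    refine absurd hp (not_lt.2 ?_)
    have hcosh : (ψ p).1 2 ≤ Real.cosh R' := by
      rw [← Real.cosh_arcosh hs, Real.cosh_le_cosh, abs_of_nonneg (Real.arcosh_nonneg hs)]
      exact hle.trans (le_abs_self _)
    rw [Prod.norm_def]
    refine max_le_max ?_ ?_
    · rw [pi_norm_le_iff_of_nonneg (Real.cosh_pos _).le]
      have h2 := hx.1
      simp only [lor] at h2
      intro i
      refine (abs_le_of_sq_le_sq ?_ (by linarith)).trans hcosh
      fin_cases i <;> simp <;> nlinarith
    · rcases le_or_gt (rad (ψ p).1) R with h1 | h1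
      · refine le_max_of_le_left (sq_le_sq.1 ?_)
        nlinarith [hρ _ ⟨p, rfl⟩ h1, sq_nonneg (rad (ψ p).1)]
      · refine le_max_of_le_right ?_
        have h2 : (ψ p).2 = g (ψ p).1 := (hg _ hx h1 _).1 ⟨p, rfl⟩
        have h3 := abs_lt.1 (hgε _ hx h1)
        have h4 : 0 < rad (ψ p).1 := hR.trans h1
        rw [h2, Real.norm_eq_abs, abs_le]
        constructor <;> linarith
  have h1 : R < rad (ψ p).1 := (le_max_left _ _).trans_lt hfar
  have h2 : (ψ p).2 = g (ψ p).1 := (hg _ hx h1 _).1 ⟨p, rfl⟩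
  have h3 := abs_lt.1 (hgε _ hx h1)
  have h4 : s₀ ≤ (ψ p).1 2 := by
    refine (le_max_left s₀ 1).trans ?_
    rw [← Real.arcosh_le_arcosh (by positivity) (by linarith)]
    exact (le_max_right _ _).trans hfar.le
  have h5 := hs₀ _ h4
  rw [Real.dist_eq, sub_zero] at h5 ⊢
  have h6 := abs_lt.1 h5
  simp only [rad] at h3
  rw [h2, abs_lt]
  constructor <;> linarith

/-- A properly immersed translating soliton asymptotic to the bowl soliton lies on it. -/
theorem IsTranslatingSoliton.height_eq {S : Type*} [TopologicalSpace S] [ChartedSpace Plane S]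
    {ψ : S → L3 × ℝ} (hψ : IsTranslatingSoliton ψ) (hproper : IsProperMap ψ)
    (hasymp : IsC1AsymptoticToBowl (range ψ)) {F P P' : ℝ → ℝ} (hF : IsBowlHeight F P P') (p : S) :
    (ψ p).2 = F ((ψ p).1 2) := by
  have hs : ∀ q, 1 ≤ (ψ q).1 2 := fun q => one_le_of_mem_H2 (hψ.1.mem_H2 q)
  have hFc : Continuous F := continuous_iff_continuousAt.2 fun s => (hF.deriv s).continuousAt
  have hsc : Continuous fun q => (ψ q).1 2 := (continuous_apply 2).comp hproper.continuous.fst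
  rw [← sub_eq_zero]
  refine eq_zero_of_forall_mul_le_sq fun τ hτ hτ0 => ?_
  by_contra! hcon
  have hpos : 0 < τ * ((ψ p).2 - (F ((ψ p).1 2) + τ * ((ψ p).1 2)⁻¹)) := by
    have : τ ^ 2 * ((ψ p).1 2)⁻¹ ≤ τ ^ 2 := mul_le_of_le_one_right (sq_nonneg τ)
      (inv_le_one_of_one_le₀ (hs p))
    nlinarith
  have hcont : Continuous fun q => τ * ((ψ q).2 - (F ((ψ q).1 2) + τ * ((ψ q).1 2)⁻¹)) :=
    continuous_const.mul (hproper.continuous.snd.sub ((hFc.comp hsc).add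
      (continuous_const.mul (hsc.inv₀ fun q => by linarith [hs q]))))
  -- The function is `τ (z - F) - τ² / s`: the first term tends to `0` and the second is
  -- nonpositive, so near infinity it stays below its positive value at `p`.
  obtain ⟨q, hq⟩ := hcont.exists_forall_ge' p (by
    have h0 := (hasymp.tendsto hψ.1.mem_H2 hproper hF).const_mul τ
    rw [mul_zero] at h0
    filter_upwards [h0.eventually_lt_const hpos] with q hq
    have : 0 ≤ τ ^ 2 * ((ψ q).1 2)⁻¹ := mul_nonneg (sq_nonneg τ)
      (inv_nonneg.2 (by linarith [hs q]))
    nlinarith)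
  exact hψ.not_isLocalMax hF hτ hτ0 q (.of_forall hq)

/-! ### Bowl solitons differ by vertical translations -/

theorem hypParam_mem_H2 (w : Plane) : hypParam w ∈ H2 := by
  have h : 0 < 1 + w 0 ^ 2 + w 1 ^ 2 := by positivity
  refine ⟨?_, Real.sqrt_pos.2 h⟩
  simp [lor, hypParam]
  rw [Real.mul_self_sqrt h.le]
  ring

theorem hypParam_two (w : Plane) : hypParam w 2 = √(1 + ‖w‖ ^ 2) := by
  simp [hypParam, EuclideanSpace.norm_sq_eq, Fin.sum_univ_two, add_assoc]

/-- A bowl soliton is the graph of a vertical translate of any bowl height function. -/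
theorem IsTranslatingSoliton.rotGraph_eq {f : ℝ → ℝ} (hf : IsTranslatingSoliton (rotGraph f))
    {F P P' : ℝ → ℝ} (hF : IsBowlHeight F P P') :
    ∃ c, ∀ w, rotGraph f w = (hypParam w, F (hypParam w 2) + c) := by
  have hs : ∀ w, 1 ≤ hypParam w 2 := fun w => one_le_of_mem_H2 (hypParam_mem_H2 w)
  have hFc : Continuous F := continuous_iff_continuousAt.2 fun s => (hF.deriv s).continuousAt
  have hψ : Continuous (rotGraph f) := hf.1.smooth.continuous
  have hsc : Continuous fun w => hypParam w 2 := (continuous_apply 2).comp hψ.fst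
  have key : ∀ w₁ w : Plane, ‖w‖ ≤ ‖w₁‖ →
      (rotGraph f w).2 - F (hypParam w 2) = (rotGraph f w₁).2 - F (hypParam w₁ 2) := by
    intro w₁ w hw
    rw [← sub_eq_zero]
    refine eq_zero_of_forall_mul_le_sq fun τ hτ hτ0 => ?_
    set h : Plane → ℝ := fun q =>
      τ * ((rotGraph f q).2 - (F ((rotGraph f q).1 2) + τ * ((rotGraph f q).1 2)⁻¹)) with hh
    have hcont : Continuous h :=
      continuous_const.mul (hψ.snd.sub ((hFc.comp hsc).add
        (continuous_const.mul (hsc.inv₀ fun q => by linarith [hs q]))))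
    obtain ⟨q, hq, hmax⟩ := (isCompact_closedBall (0 : Plane) ‖w₁‖).exists_isMaxOn ⟨0, by simp⟩
      hcont.continuousOn
    -- The maximum over the disc lies on the boundary circle, where `h` is constant by rotational
    -- symmetry; it therefore equals `h w₁`.
    have hq1 : ‖q‖ = ‖w₁‖ := by
      refine le_antisymm (by simpa using hq) (not_lt.1 fun hlt => ?_)
      refine hf.not_isLocalMax hF hτ hτ0 q (hmax.isLocalMax ?_)
      exact mem_of_superset (Metric.isOpen_ball.mem_nhds (by simpa using hlt))
        Metric.ball_subset_closedBall
    have h1 : h w ≤ h w₁ := by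
      have e : h q = h w₁ := by
        simp only [hh, rotGraph, rad, hypParam_two, hq1]
      exact e ▸ hmax (by simpa using hw)
    have h2 : τ ^ 2 * (hypParam w 2)⁻¹ ≤ τ ^ 2 := mul_le_of_le_one_right (sq_nonneg τ)
      (inv_le_one_of_one_le₀ (hs w))
    have h3 : 0 ≤ τ ^ 2 * (hypParam w₁ 2)⁻¹ := mul_nonneg (sq_nonneg τ)
      (inv_nonneg.2 (by linarith [hs w₁]))
    have e : ∀ v, (rotGraph f v).1 = hypParam v := fun _ => rfl
    simp only [hh, e] at h1
    nlinarith
  refine ⟨(rotGraph f 0).2 - F (hypParam 0 2), fun w => ?_⟩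
  have := key w 0 (by simp)
  ext1
  · rfl
  · simp only
    linarith

/-! ### Projection of a surface contained in the graph -/

/-- The projection of `L3 × ℝ` to the plane of the first two coordinates. -/
noncomputable def planeProj : L3 × ℝ →L[ℝ] Plane :=
  ((EuclideanSpace.equiv (Fin 2) ℝ).symm : (Fin 2 → ℝ) →L[ℝ] Plane).comp
    (ContinuousLinearMap.pi fun i : Fin 2 =>
      (ContinuousLinearMap.proj (R := ℝ) (φ := fun _ : Fin 3 => ℝ) i.castSucc).comp
        (ContinuousLinearMap.fst ℝ L3 ℝ))

/-- The rotational graph of the function `F(x₃)`. -/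
noncomputable def heightGraph (F : ℝ → ℝ) (w : Plane) : L3 × ℝ := (hypParam w, F (hypParam w 2))

theorem planeProj_heightGraph (F : ℝ → ℝ) (w : Plane) : planeProj (heightGraph F w) = w := by
  ext i
  fin_cases i <;> rfl

theorem hypParam_planeProj {q : L3 × ℝ} (hq : q.1 ∈ H2) : hypParam (planeProj q) = q.1 := by
  have h1 := hq.1
  simp only [lor] at h1
  ext i
  fin_cases i
  · rfl
  · rfl
  · change √(1 + q.1 0 ^ 2 + q.1 1 ^ 2) = q.1 2
    rw [Real.sqrt_eq_iff_mul_self_eq_of_pos hq.2]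
    linarith

theorem heightGraph_planeProj {F : ℝ → ℝ} {q : L3 × ℝ} (hq : q.1 ∈ H2) (hF : q.2 = F (q.1 2)) :
    heightGraph F (planeProj q) = q := by
  rw [heightGraph, hypParam_planeProj hq, ← hF]

theorem continuous_heightGraph {F : ℝ → ℝ} (hF : Continuous F) : Continuous (heightGraph F) := by
  have h : Continuous hypParam := by
    refine continuous_pi fun i => ?_
    fin_cases i
    · exact (by fun_prop : Continuous fun w : Plane => w 0)
    · exact (by fun_prop : Continuous fun w : Plane => w 1)
    · exact (by fun_prop : Continuous fun w : Plane => √(1 + w 0 ^ 2 + w 1 ^ 2))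
  exact h.prodMk (hF.comp ((continuous_apply 2).comp h))

section Surface

variable {S : Type*} [TopologicalSpace S] [ChartedSpace Plane S] {ψ : S → L3 × ℝ} {F P : ℝ → ℝ}

theorem IsImmersedSurface.tangent_of_height_eq (hψ : IsImmersedSurface ψ)
    (hF : ∀ s, HasDerivAt F (P s) s) (heq : ∀ p, (ψ p).2 = F ((ψ p).1 2)) (p : S) (ξ : Plane) :
    lor (ψ p).1 (fderiv ℝ (localParam ψ p) (extChartAt 𝓘(ℝ, Plane) p p) ξ).1 = 0 ∧
      (fderiv ℝ (localParam ψ p) (extChartAt 𝓘(ℝ, Plane) p p) ξ).2 =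
        P ((ψ p).1 2) * (fderiv ℝ (localParam ψ p) (extChartAt 𝓘(ℝ, Plane) p p) ξ).1 2 := by
  have hXp : localParam ψ p (extChartAt 𝓘(ℝ, Plane) p p) = ψ p := by
    simp [localParam]
  obtain ⟨h1, h2⟩ := hasDerivAt_line (hψ.contDiffAt_localParam p) ξ
  have h3 := (lor_curve h1 h2 fun t => hψ.mem_H2 _).1
  have h4 := h1.self_of_nhds
  have h5 := hasDerivAt_height h4
  have h6 := (hF _).comp 0 (hasDerivAt_coord h4 2)
  have e : (fun t : ℝ => (localParam ψ p (extChartAt 𝓘(ℝ, Plane) p p + t • ξ)).2) =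
      F ∘ fun t : ℝ => (localParam ψ p (extChartAt 𝓘(ℝ, Plane) p p + t • ξ)).1 2 :=
    funext fun t => heq _
  rw [e] at h5
  have h7 := h5.unique h6
  rw [zero_smul, add_zero, hXp] at h3 h7
  exact ⟨h3, h7⟩

/-- A surface contained in the graph of `F(x₃)` is locally parametrized by its projection to the
plane. -/
theorem IsImmersedSurface.exists_local_inverse (hψ : IsImmersedSurface ψ)
    (hF : ∀ s, HasDerivAt F (P s) s) (heq : ∀ p, (ψ p).2 = F ((ψ p).1 2)) (p : S) :
    ∃ e : OpenPartialHomeomorph Plane Plane, extChartAt 𝓘(ℝ, Plane) p p ∈ e.source ∧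
      (∀ u, e u = planeProj (localParam ψ p u)) ∧ ContDiffAt ℝ ∞ e.symm (planeProj (ψ p)) := by
  have hX := hψ.contDiffAt_localParam p
  have hXp : localParam ψ p (extChartAt 𝓘(ℝ, Plane) p p) = ψ p := by
    simp [localParam]
  have hinj := hψ.immersion p
  rw [hψ.mfderiv_eq p] at hinj
  have htan := hψ.tangent_of_height_eq hF heq p
  set A := fderiv ℝ (localParam ψ p) (extChartAt 𝓘(ℝ, Plane) p p)
  -- A tangent vector with zero planar projection has zero hyperbolic part by tangency, and then
  -- zero height because `dz = P dx₃`.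
  have hinj' : Function.Injective (planeProj.comp A) := by
    rw [injective_iff_map_eq_zero]
    intro ξ hξ
    have h0 : (A ξ).1 0 = 0 := congrArg (fun u : Plane => u 0) hξ
    have h1 : (A ξ).1 1 = 0 := congrArg (fun u : Plane => u 1) hξ
    have h2 := eq_zero_of_tangent (hψ.mem_H2 p) (htan ξ).1 h0 h1
    have h3 : A ξ = 0 := Prod.ext h2 ((htan ξ).2.trans (by rw [h2]; simp))
    exact hinj (h3.trans (map_zero A).symm)
  have hsurj : Function.Surjective (planeProj.comp A) :=
    LinearMap.injective_iff_surjective (f := ((planeProj.comp A : Plane →L[ℝ] Plane) :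
      Plane →ₗ[ℝ] Plane)).1 hinj'
  let L : Plane ≃L[ℝ] Plane := ContinuousLinearEquiv.ofBijective (planeProj.comp A)
    (LinearMap.ker_eq_bot.2 hinj') (LinearMap.range_eq_top.2 hsurj)
  have hc : ContDiffAt ℝ ∞ (fun u => planeProj (localParam ψ p u)) (extChartAt 𝓘(ℝ, Plane) p p) :=
    planeProj.contDiff.contDiffAt.comp _ hX
  have hd : HasFDerivAt (fun u => planeProj (localParam ψ p u)) (L : Plane →L[ℝ] Plane)
      (extChartAt 𝓘(ℝ, Plane) p p) :=
    planeProj.hasFDerivAt.comp _ (hX.differentiableAt (by simp)).hasFDerivAt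
  refine ⟨hc.toOpenPartialHomeomorph _ hd (by simp), hc.mem_toOpenPartialHomeomorph_source hd _,
    fun u => rfl, ?_⟩
  have := hc.to_localInverse hd (by simp)
  rw [hXp] at this
  exact this

theorem IsImmersedSurface.isLocalHomeomorph_planeProj (hψ : IsImmersedSurface ψ)
    (hF : ∀ s, HasDerivAt F (P s) s) (heq : ∀ p, (ψ p).2 = F ((ψ p).1 2)) :
    IsLocalHomeomorph fun p => planeProj (ψ p) := by
  refine IsLocalHomeomorph.mk _ fun p => ?_
  obtain ⟨e, he, hee, -⟩ := hψ.exists_local_inverse hF heq p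
  refine ⟨(chartAt Plane p).trans e, ?_, fun q hq => ?_⟩
  · rw [OpenPartialHomeomorph.trans_source]
    exact ⟨mem_chart_source _ _, by simpa using he⟩
  · rw [OpenPartialHomeomorph.trans_source] at hq
    have : localParam ψ p (chartAt Plane p q) = ψ q := by
      simp [localParam, (chartAt Plane p).left_inv hq.1]
    rw [OpenPartialHomeomorph.trans_apply, hee, this]

/-- The projection is proper because the preimage of `K` is the `ψ`-preimage of the compact piece of
the graph over `K`; the plane is simply connected. -/
theorem IsImmersedSurface.isHomeomorph_planeProj [T2Space S] [ConnectedSpace S]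
    (hψ : IsImmersedSurface ψ) (hproper : IsProperMap ψ) (hF : ∀ s, HasDerivAt F (P s) s)
    (heq : ∀ p, (ψ p).2 = F ((ψ p).1 2)) : IsHomeomorph fun p => planeProj (ψ p) := by
  have hFc : Continuous F := continuous_iff_continuousAt.2 fun s => (hF s).continuousAt
  refine isHomeomorph_of_isProperMap_of_isLocalHomeomorph ?_
    (hψ.isLocalHomeomorph_planeProj hF heq)
  refine isProperMap_iff_isCompact_preimage.2
    ⟨planeProj.continuous.comp hproper.continuous, fun K hK => ?_⟩
  convert hproper.isCompact_preimage (hK.image (continuous_heightGraph hFc)) using 1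
  ext p
  constructor
  · exact fun hp => ⟨_, hp, heightGraph_planeProj (hψ.mem_H2 p) (heq p)⟩
  · rintro ⟨w, hw, hp⟩
    change planeProj (ψ p) ∈ K
    rwa [← hp, planeProj_heightGraph]

/-- Locally the graph map is `ψ` in a chart composed with the smooth inverse of its projection.
Smoothness thus comes from `ψ`, with no regularity analysis of the singular slope equation. -/
theorem IsImmersedSurface.contDiff_heightGraph (hψ : IsImmersedSurface ψ)
    (hF : ∀ s, HasDerivAt F (P s) s) (heq : ∀ p, (ψ p).2 = F ((ψ p).1 2))
    (hsurj : Function.Surjective fun p => planeProj (ψ p)) : ContDiff ℝ ∞ (heightGraph F) := by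
  rw [contDiff_iff_contDiffAt]
  intro w
  obtain ⟨p, rfl⟩ := hsurj w
  obtain ⟨e, he, hee, hsymm⟩ := hψ.exists_local_inverse hF heq p
  have hep : e (extChartAt 𝓘(ℝ, Plane) p p) = planeProj (ψ p) := by
    rw [hee]
    simp [localParam]
  have hsp : e.symm (planeProj (ψ p)) = extChartAt 𝓘(ℝ, Plane) p p := by
    rw [← hep, e.left_inv he]
  have hX := hψ.contDiffAt_localParam p
  rw [← hsp] at hX
  refine (hX.comp _ hsymm).congr_of_eventuallyEq ?_
  have ht : planeProj (ψ p) ∈ e.target := hep ▸ e.map_source he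
  filter_upwards [e.open_target.mem_nhds ht] with w hw
  nth_rewrite 1 [← e.right_inv hw]
  rw [hee]
  exact heightGraph_planeProj (hψ.mem_H2 _) (heq _)

end Surface

/-! ### The graph of the bowl height is a soliton -/

theorem continuous_graphNormal {P : ℝ → ℝ} (hP : Continuous P) {x : Plane → L3}
    (hx : Continuous x) : Continuous fun w => graphNormal (P (x w 2)) (x w) := by
  have h : ∀ i, Continuous fun w => x w i := fun i => (continuous_apply i).comp hx
  have hp := hP.comp (h 2)
  refine .prodMk (continuous_pi fun i => ?_) continuous_const
  fin_cases i
  · exact ((hp.mul (h 2)).mul (h 0)).neg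
  · exact ((hp.mul (h 2)).mul (h 1)).neg
  · exact (hp.mul (((h 2).pow 2).sub continuous_const)).neg

/-- The graph touches itself from both sides everywhere, so the curvature comparison with `σ = 1`
and `σ = -1` becomes an equality, and the slope equation turns it into `T = 2`. -/
theorem IsBowlHeight.isTranslatingSoliton {F P P' : ℝ → ℝ} (hF : IsBowlHeight F P P')
    (hsmooth : ContDiff ℝ ∞ (heightGraph F)) : IsTranslatingSoliton (heightGraph F) := by
  have hH : ∀ w, (heightGraph F w).1 ∈ H2 := hypParam_mem_H2
  have himm : IsImmersedSurface (heightGraph F) := by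
    refine ⟨hH, hsmooth.contMDiff, fun w => ?_⟩
    rw [mfderiv_eq_fderiv]
    have h1 : HasFDerivAt (fun w => planeProj (heightGraph F w))
        (planeProj.comp (fderiv ℝ (heightGraph F) w)) w :=
      planeProj.hasFDerivAt.comp w (hsmooth.differentiable (by simp) w).hasFDerivAt
    simp only [planeProj_heightGraph] at h1
    have h2 := h1.unique (hasFDerivAt_id w)
    exact Function.LeftInverse.injective (g := planeProj) fun v => DFunLike.congr_fun h2 v
  have heq : ∀ w, (heightGraph F w).2 = F ((heightGraph F w).1 2) := fun _ => rfl
  have htan := himm.tangent_of_height_eq hF.deriv heq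
  set W : Plane → ℝ := fun w =>
    1 + P ((heightGraph F w).1 2) ^ 2 * ((heightGraph F w).1 2 ^ 2 - 1) with hW
  have hWpos : ∀ w, 0 < W w := fun w => by
    have : 0 ≤ (heightGraph F w).1 2 ^ 2 - 1 := by nlinarith [one_le_of_mem_H2 (hH w)]
    positivity
  have hsc : Continuous fun w => (heightGraph F w).1 2 :=
    (continuous_apply 2).comp hsmooth.continuous.fst
  set η : Plane → L3 × ℝ := fun w =>
    (√(W w))⁻¹ • graphNormal (P ((heightGraph F w).1 2)) (heightGraph F w).1 with hηdef
  have hη : IsUnitNormal (heightGraph F) η := by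
    refine ⟨?_, fun w => ?_, fun w v => ?_, fun w => ?_⟩
    · have hWc : Continuous W :=
        continuous_const.add (((hF.slope.cont.comp hsc).pow 2).mul ((hsc.pow 2).sub continuous_const))
      exact (hWc.sqrt.inv₀ fun w => (Real.sqrt_pos.2 (hWpos w)).ne').smul
        (continuous_graphNormal hF.slope.cont hsmooth.continuous.fst)
    · rw [hηdef]
      simp only [Prod.smul_fst]
      rw [lor_smul_right, lor_graphNormal (hH w), mul_zero]
    · rw [himm.mfderiv_eq w, hηdef]
      exact (amb_smul_right _ _ _).trans
        (mul_eq_zero_of_right _ (amb_graphNormal_eq_zero (htan w v).1 (htan w v).2))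
    · simp only [hηdef]
      rw [amb_smul_left, amb_smul_right, amb_graphNormal_self (hH w)]
      have h1 := Real.mul_self_sqrt (hWpos w).le
      have h2 : √(W w) ≠ 0 := (Real.sqrt_pos.2 (hWpos w)).ne'
      change (√(W w))⁻¹ * ((√(W w))⁻¹ * W w) = 1
      field_simp
      rw [sq, h1]
  refine ⟨himm, η, hη, fun w => ?_⟩
  have hs := one_le_of_mem_H2 (hH w)
  have hmax : ∀ σ : ℝ, IsLocalMax (fun q => σ * ((heightGraph F q).2 - F ((heightGraph F q).1 2))) w :=
    fun σ => .of_forall fun q => by simp [heq]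
  obtain ⟨h1, T, hT, hle⟩ := himm.touching hη (σ := 1) one_ne_zero (.of_forall hF.deriv)
    (hF.slope.deriv _ hs) (hmax 1)
  obtain ⟨-, T', hT', hle'⟩ := himm.touching hη (σ := -1) (by norm_num) (.of_forall hF.deriv)
    (hF.slope.deriv _ hs) (hmax (-1))
  have hη0 : (η w).2 ≠ 0 := by
    intro h0
    simp [h0] at h1
  have hTT : T' = T := mul_left_cancel₀ hη0 (by linarith)
  have heqn := hF.slope.eqn _ hs
  have hT2 : T * W w = 2 * W w := by
    rw [hTT] at hle'
    simp only [hW]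
    linarith
  rw [mul_right_cancel₀ (hWpos w).ne' hT2] at hT
  rw [amb_dz]
  linarith

theorem rotGraph_comp_cosh (F : ℝ → ℝ) : rotGraph (F ∘ Real.cosh) = heightGraph F := by
  funext w
  simp [rotGraph, heightGraph, rad, Real.cosh_arcosh (one_le_of_mem_H2 (hypParam_mem_H2 w))]

end HypTranslator

/-! ### The main theorem -/

theorem mainTheorem1 {S : Type*} [TopologicalSpace S] [T2Space S] [SecondCountableTopology S]
    [ConnectedSpace S] [ChartedSpace HypTranslator.Plane S]
    [IsManifold 𝓘(ℝ, HypTranslator.Plane) ∞ S]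
    (ψ : S → HypTranslator.L3 × ℝ)
    (hsoliton : HypTranslator.IsTranslatingSoliton ψ)
    (hproper : IsProperMap ψ)
    (hend : HypTranslator.HasSingleEnd S)
    (hasymp : HypTranslator.IsC1AsymptoticToBowl (Set.range ψ)) :
    Topology.IsEmbedding ψ ∧
      (∃ B : Set (HypTranslator.L3 × ℝ), HypTranslator.IsBowlSoliton B) ∧
      ∀ B : Set (HypTranslator.L3 × ℝ), HypTranslator.IsBowlSoliton B →
        ∃ c : ℝ, Set.range ψ = HypTranslator.verticalTranslate c B := by
  obtain ⟨F, P, P', hF⟩ := HypTranslator.exists_isBowlHeight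
  have heq := hsoliton.height_eq hproper hasymp hF
  have hhom := hsoliton.1.isHomeomorph_planeProj hproper hF.deriv heq
  have hinj : Function.Injective ψ := fun p q hpq => hhom.injective (by simp only [hpq])
  have hrange : Set.range ψ = Set.range (HypTranslator.heightGraph F) := by
    ext q
    constructor
    · rintro ⟨p, rfl⟩
      exact ⟨_, HypTranslator.heightGraph_planeProj (hsoliton.1.mem_H2 p) (heq p)⟩
    · rintro ⟨w, rfl⟩
      obtain ⟨p, rfl⟩ := hhom.surjective w
      exact ⟨p, (HypTranslator.heightGraph_planeProj (hsoliton.1.mem_H2 p) (heq p)).symm⟩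
  refine ⟨(Topology.IsClosedEmbedding.of_continuous_injective_isClosedMap hproper.continuous hinj
    hproper.isClosedMap).isEmbedding, ⟨_, F ∘ Real.cosh, ?_, rfl⟩, ?_⟩
  · rw [HypTranslator.rotGraph_comp_cosh]
    exact hF.isTranslatingSoliton
      (hsoliton.1.contDiff_heightGraph hF.deriv heq hhom.surjective)
  · rintro _ ⟨f, hf, rfl⟩
    obtain ⟨c, hc⟩ := hf.rotGraph_eq hF
    -- `B` is the graph of `F + c`, while the image of `ψ` is the graph of `F`.
    refine ⟨-c, ?_⟩
    rw [hrange, HypTranslator.verticalTranslate, ← Set.range_comp]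
    congr 1
    funext w
    simp [hc, HypTranslator.heightGraph]
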